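/- **Setting.** A *quad-equation* is an equation $Q=0$ where $Q=Q(x,y,z,w)\in\mathbb{C}[x,y,z,w]$ is irreducible over $\mathbb{C}$ and of degree exactly $1$ in each of its four variables. Let $u_1,\dots,u_6$ be variables attached to the vertices of an octahedron, with opposite pairs $\{u_1,u_4\}$, $\{u_2,u_5\}$, $\{u_3,u_6\}$. An *octahedron with quad-equations* $\{Q_1,Q_2,Q_3\}$ consists of three quad-equations $$Q_1(u_4,u_2,u_1,u_5)=0,\qquad Q_2(u_2,u_6,u_5,u_3)=0,\qquad Q_3(u_6,u_4,u_3,u_1)=0 .$$ It has the *consistency around an octahedron (CAO) property* if each of the three equations can be obtained from the other two: whenever one of the other two equations is solved for a variable that does not occur in the second, and the second is solved for a variable that does not occur in the first (the remaining four variables being arbitrary initial values for which these linear equations are uniquely solvable), the resulting values satisfy the remaining equation. Let $G^{(o)}=\langle (1\,4),(2\,5),(3\,6),(2\,3\,5\,6),(1\,3\,4\,6),(1\,2\,4\,5)\rangle\le\mathfrak{S}_6$ act by $\sigma.u_i=u_{\sigma(i)}$. A Möbius transformation $r$ acts by $r.u_i=\frac{A_iu_i+B_i}{C_iu_i+D_i}$,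 $A_iD_i-B_iC_i\neq0$ ($i=1,\dots,6$, independently for each $i$), and on a polynomial by substitution followed by multiplication with $C_iu_i+D_i$ for each of the variables $u_i$ of the quad-equation. Write $\{P,Q,R\}\sim_o\{P',Q',R'\}$ if there are a Möbius transformation $r$ and $\sigma\in G^{(o)}$ such that $\{P',Q',R'\}$ and $\{r.\sigma.P,\,r.\sigma.Q,\,r.\sigma.R\}$ agree as unordered triples of polynomials up to nonzero constant factors. Put $$\begin{aligned} \mathrm{N3}(x,y,z,w;\alpha_1,\alpha_2,\alpha_3,\alpha_4)&=\alpha_1xy+\alpha_2zw+\alpha_3xw+\alpha_4yz,\\ \mathrm{N2}(x,y,z,w;\alpha_1,\alpha_2,\alpha_3,\alpha_4)&=(x+z)(\alpha_1y+\alpha_2w)+\alpha_3y+\alpha_4w,\\ \mathrm{N1}(x,y,z,w;\alpha_1,\alpha_2,\alpha_3,\alpha_4)&=\alpha_1(x+z)(y+w)+\alpha_2(x+z)+\alpha_3(y+w)+\alpha_4 . \end{aligned}$$ **Lemma (CAO classification).** Every octahedron with quad-equations $\{Q_1,Q_2,Q_3\}$ that has the CAO property is equivalent under $\sim_o$ to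 one of the following four systems, for some $\alpha_1,\dots,\alpha_8\in\mathbb{C}$, where $\alpha_{i,j}=\alpha_i\alpha_j$: $$\begin{cases} \mathrm{N3}(u_4,u_2,u_1,u_5;\alpha_1,\alpha_2,\alpha_3,\alpha_4),\\ \mathrm{N3}(u_2,u_6,u_5,u_3;\alpha_5,\alpha_6,\alpha_7,\alpha_8),\\ \mathrm{N3}(u_6,u_4,u_3,u_1;\alpha_{1,8}-\alpha_{3,5},\,\alpha_{4,6}-\alpha_{2,7},\,\alpha_{4,8}-\alpha_{2,5},\,\alpha_{1,6}-\alpha_{3,7}); \end{cases}$$ $$\begin{cases} \mathrm{N2}(u_2,u_4,u_5,u_1;\alpha_1,\alpha_2,\alpha_3,\alpha_4),\\ \mathrm{N2}(u_2,u_6,u_5,u_3;\alpha_5,\alpha_6,\alpha_7,\alpha_8),\\ \mathrm{N3}(u_6,u_4,u_3,u_1;\alpha_{3,5}-\alpha_{1,7},\,\alpha_{4,6}-\alpha_{2,8},\,\alpha_{4,5}-\alpha_{2,7},\,\alpha_{3,6}-\alpha_{1,8}); \end{cases}$$ $$\begin{cases} \mathrm{N2}(u_4,u_2,u_1,u_5;\alpha_1,\alpha_2,\alpha_3,\alpha_4),\\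 \mathrm{N2}(u_6,u_2,u_3,u_5;\alpha_5,\alpha_6,\alpha_7,\alpha_8),\\ \mathrm{N1}(u_6,u_4,u_3,u_1;\alpha_{2,5}-\alpha_{1,6},\,\alpha_{4,5}-\alpha_{3,6},\,\alpha_{2,7}-\alpha_{1,8},\,\alpha_{4,7}-\alpha_{3,8}); \end{cases}$$ $$\begin{cases} \mathrm{N1}(u_4,u_2,u_1,u_5;\alpha_1,\alpha_2,\alpha_3,\alpha_4),\\ \mathrm{N1}(u_2,u_6,u_5,u_3;\alpha_5,\alpha_6,\alpha_7,\alpha_8),\\ \mathrm{N1}(u_6,u_4,u_3,u_1;\alpha_{2,5}-\alpha_{1,7},\,\alpha_{4,5}-\alpha_{3,7},\,\alpha_{2,6}-\alpha_{1,8},\,\alpha_{4,6}-\alpha_{3,8}). \end{cases}$$ -/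

import Mathlib

open MvPolynomial

namespace CAO

/-- A quad-equation `Q(x,y,z,w) = 0`, represented by its polynomial: `Q` is affine-linear in each of
its four variables, really depends on each of them, and is irreducible over `ℂ`. -/
def IsQuadEquation (Q : MvPolynomial (Fin 4) ℂ) : Prop :=
  Irreducible Q ∧ ∀ i, Q.degreeOf i = 1

/-- The six vertex variables `u₁, …, u₆` of the octahedron are indexed by their labels modulo `6`;
thus `u₆` is the variable with index `(6 : Fin 6) = 0`. Opposite vertices are `1,4`; `2,5`; `3,6`. -/
noncomputable abbrev u (i : Fin 6) : MvPolynomial (Fin 6) ℂ := X i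

/-- The three quad-equations `Q₁(u₄,u₂,u₁,u₅)`, `Q₂(u₂,u₆,u₅,u₃)`, `Q₃(u₆,u₄,u₃,u₁)` placed on the
three interior quadrilaterals of the octahedron. -/
noncomputable def octahedron (Q₁ Q₂ Q₃ : MvPolynomial (Fin 4) ℂ) :
    Fin 3 → MvPolynomial (Fin 6) ℂ :=
  ![rename ![4, 2, 1, 5] Q₁, rename ![2, 6, 5, 3] Q₂, rename ![6, 4, 3, 1] Q₃]

/-- The equation `R = 0` is obtained from `P = 0` and `Q = 0`: whenever `P = 0` is solved for a
vertex variable `u_a` that does not occur in `Q`, and `Q = 0` is solved for a vertex variable `u_b`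
that does not occur in `P` (the other four variables being initial values), the result satisfies
`R = 0`. As `P` is affine-linear in `u_a`, it can be solved (uniquely) for `u_a` exactly when
`∂P/∂u_a ≠ 0`; likewise for `Q`. -/
def ObtainedFrom (R P Q : MvPolynomial (Fin 6) ℂ) : Prop :=
  ∀ a ∈ P.vars \ Q.vars, ∀ b ∈ Q.vars \ P.vars, ∀ v : Fin 6 → ℂ,
    eval v (pderiv a P) ≠ 0 → eval v (pderiv b Q) ≠ 0 →
      eval v P = 0 → eval v Q = 0 → eval v R = 0

/-- Consistency around an octahedron: each of the three equations is obtained from the other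
two. -/
def HasCAO (E : Fin 3 → MvPolynomial (Fin 6) ℂ) : Prop :=
  ObtainedFrom (E 0) (E 1) (E 2) ∧ ObtainedFrom (E 1) (E 0) (E 2) ∧ ObtainedFrom (E 2) (E 0) (E 1)

/-- The symmetry group of the octahedron, as a group of permutations of the vertex labels. -/
def octahedralGroup : Subgroup (Equiv.Perm (Fin 6)) :=
  Subgroup.closure
    {Equiv.swap 1 4, Equiv.swap 2 5, Equiv.swap 3 6,
      [2, 3, 5, 6].formPerm, [1, 3, 4, 6].formPerm, [1, 2, 4, 5].formPerm}

/-- Action of the Möbius transformation `uᵢ ↦ (Aᵢ uᵢ + Bᵢ) / (Cᵢ uᵢ + Dᵢ)`, where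
`r i = !![Aᵢ, Bᵢ; Cᵢ, Dᵢ]`, on a polynomial: the substitution is made and the denominators are
cleared, i.e. the result is `∏ᵢ (Cᵢ uᵢ + Dᵢ) ^ deg_{uᵢ} P` times `P` at the transformed variables.
(No subtraction is truncated, as `m i ≤ degreeOf i P` for each monomial `m` of `P`.) -/
noncomputable def mobius (r : Fin 6 → Matrix (Fin 2) (Fin 2) ℂ) (P : MvPolynomial (Fin 6) ℂ) :
    MvPolynomial (Fin 6) ℂ :=
  ∑ m ∈ P.support, C (P.coeff m) *
    ∏ i, (C (r i 0 0) * u i + C (r i 0 1)) ^ m i *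
      (C (r i 1 0) * u i + C (r i 1 1)) ^ (P.degreeOf i - m i)

/-- Equivalence of triples of quad-equations on the octahedron modulo Möbius transformations of the
six variables and the octahedral symmetries `σ.uᵢ = u_{σ(i)}`: after such a transformation the
two unordered triples agree up to nonzero constant factors. -/
def OctEquiv (E E' : Fin 3 → MvPolynomial (Fin 6) ℂ) : Prop :=
  ∃ r : Fin 6 → Matrix (Fin 2) (Fin 2) ℂ, (∀ i, (r i).det ≠ 0) ∧
    ∃ σ ∈ octahedralGroup, ∃ τ : Equiv.Perm (Fin 3), ∀ i, ∃ c : ℂ, c ≠ 0 ∧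
      E' i = C c * mobius r (rename σ (E (τ i)))

noncomputable def N3 (x y z w : MvPolynomial (Fin 6) ℂ) (α₁ α₂ α₃ α₄ : ℂ) :
    MvPolynomial (Fin 6) ℂ :=
  C α₁ * (x * y) + C α₂ * (z * w) + C α₃ * (x * w) + C α₄ * (y * z)

noncomputable def N2 (x y z w : MvPolynomial (Fin 6) ℂ) (α₁ α₂ α₃ α₄ : ℂ) :
    MvPolynomial (Fin 6) ℂ :=
  (x + z) * (C α₁ * y + C α₂ * w) + C α₃ * y + C α₄ * w

noncomputable def N1 (x y z w : MvPolynomial (Fin 6) ℂ) (α₁ α₂ α₃ α₄ : ℂ) :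
    MvPolynomial (Fin 6) ℂ :=
  C α₁ * ((x + z) * (y + w)) + C α₂ * (x + z) + C α₃ * (y + w) + C α₄

noncomputable def systemN333 (α₁ α₂ α₃ α₄ α₅ α₆ α₇ α₈ : ℂ) : Fin 3 → MvPolynomial (Fin 6) ℂ :=
  ![N3 (u 4) (u 2) (u 1) (u 5) α₁ α₂ α₃ α₄,
    N3 (u 2) (u 6) (u 5) (u 3) α₅ α₆ α₇ α₈,
    N3 (u 6) (u 4) (u 3) (u 1)
      (α₁ * α₈ - α₃ * α₅) (α₄ * α₆ - α₂ * α₇) (α₄ * α₈ - α₂ * α₅) (α₁ * α₆ - α₃ * α₇)]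

noncomputable def systemN223 (α₁ α₂ α₃ α₄ α₅ α₆ α₇ α₈ : ℂ) : Fin 3 → MvPolynomial (Fin 6) ℂ :=
  ![N2 (u 2) (u 4) (u 5) (u 1) α₁ α₂ α₃ α₄,
    N2 (u 2) (u 6) (u 5) (u 3) α₅ α₆ α₇ α₈,
    N3 (u 6) (u 4) (u 3) (u 1)
      (α₃ * α₅ - α₁ * α₇) (α₄ * α₆ - α₂ * α₈) (α₄ * α₅ - α₂ * α₇) (α₃ * α₆ - α₁ * α₈)]

noncomputable def systemN221 (α₁ α₂ α₃ α₄ α₅ α₆ α₇ α₈ : ℂ) : Fin 3 → MvPolynomial (Fin 6) ℂ :=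
  ![N2 (u 4) (u 2) (u 1) (u 5) α₁ α₂ α₃ α₄,
    N2 (u 6) (u 2) (u 3) (u 5) α₅ α₆ α₇ α₈,
    N1 (u 6) (u 4) (u 3) (u 1)
      (α₂ * α₅ - α₁ * α₆) (α₄ * α₅ - α₃ * α₆) (α₂ * α₇ - α₁ * α₈) (α₄ * α₇ - α₃ * α₈)]

noncomputable def systemN111 (α₁ α₂ α₃ α₄ α₅ α₆ α₇ α₈ : ℂ) : Fin 3 → MvPolynomial (Fin 6) ℂ :=
  ![N1 (u 4) (u 2) (u 1) (u 5) α₁ α₂ α₃ α₄,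
    N1 (u 2) (u 6) (u 5) (u 3) α₅ α₆ α₇ α₈,
    N1 (u 6) (u 4) (u 3) (u 1)
      (α₂ * α₅ - α₁ * α₇) (α₄ * α₅ - α₃ * α₇) (α₂ * α₆ - α₁ * α₈) (α₄ * α₆ - α₃ * α₈)]

end CAO

/-!
A polynomial of degree one in each of four variables is a `4 × 4` matrix of coefficients, that is, a
bilinear map between the bilinear forms in one pair of opposite variables and those in the other.
For a quad-equation, irreducibility keeps the rank of this matrix above one, and it makes the
determinant of the form obtained by fixing one pair of variables a nonzero polynomial: otherwise
`Q * ∂ᵢ∂ⱼQ = ∂ᵢQ * ∂ⱼQ`, so that `Q` would divide `∂ᵢQ` or `∂ⱼQ`.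

Consistency, extended bilinearly from the solutions of two equations to all forms annihilating them,
shows that the matrices have rank two and that the two equations containing a given pair of opposite
variables determine the same pencil of forms in that pair. A pencil containing a nondegenerate form
meets the quadric of forms of rank one in two points or is tangent to it, so Möbius transformations
make it the span of `x, z` or of `x + z, 1`. In these generators the equations have `2 × 2`
coefficient matrices, and consistency forces the third to be proportional to `Bᵀ J Aᵀ`, where `A`
and `B` are the first two and `J` is the symplectic form. Two of the three pencils have the same
type; after a rotation of the octahedron they belong to the pairs `1, 4` and `3, 6`, which leaves
the four systems.
-/

namespace CAO

open Matrix

section LinearAlgebra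

variable {K m n : Type*} [Field K] [Fintype m] [Fintype n]

theorem exists_dotProduct_smul_eq (p : m → K) : ∃ φ : m → K, (φ ⬝ᵥ p) • p = p := by
  classical
  by_cases hp : p = 0
  · exact ⟨0, by rw [hp, smul_zero]⟩
  · obtain ⟨i, hi⟩ := Function.ne_iff.1 hp
    exact ⟨Pi.single i (p i)⁻¹, by rw [single_dotProduct, inv_mul_cancel₀ hi, one_smul]⟩

theorem exists_eq_vecMulVec_add_vecMulVec {M : Matrix m n K} {p : m → K} {q : n → K}
    (h : ∀ φ ψ, φ ⬝ᵥ p = 0 → ψ ⬝ᵥ q = 0 → φ ⬝ᵥ M *ᵥ ψ = 0) :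
    ∃ a b, M = vecMulVec p b + vecMulVec a q := by
  classical
  obtain ⟨φ₀, hφ₀⟩ := exists_dotProduct_smul_eq p
  obtain ⟨ψ₀, hψ₀⟩ := exists_dotProduct_smul_eq q
  refine ⟨M *ᵥ ψ₀, φ₀ ᵥ* M - (φ₀ ⬝ᵥ M *ᵥ ψ₀) • q, ext_iff.1 fun i j => ?_⟩
  have key := h (Pi.single i 1 - p i • φ₀) (Pi.single j 1 - q j • ψ₀)
    (by rw [sub_dotProduct, single_one_dotProduct, smul_dotProduct, smul_eq_mul, mul_comm,
      ← smul_eq_mul, ← Pi.smul_apply, hφ₀, sub_self])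
    (by rw [sub_dotProduct, single_one_dotProduct, smul_dotProduct, smul_eq_mul, mul_comm,
      ← smul_eq_mul, ← Pi.smul_apply, hψ₀, sub_self])
  simp only [mulVec_sub, mulVec_smul, sub_dotProduct, dotProduct_sub, smul_dotProduct,
    dotProduct_smul, single_one_dotProduct, mulVec_single_one, col_apply, smul_eq_mul] at key
  simp only [vecMulVec_apply, Matrix.add_apply, Pi.sub_apply, Pi.smul_apply, smul_eq_mul]
  change M i j = p i * (φ₀ ⬝ᵥ M.col j - φ₀ ⬝ᵥ M *ᵥ ψ₀ * q j) + (M *ᵥ ψ₀) i * q j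
  linear_combination key

theorem mem_range_and_rank_eq_two {M : Matrix m n K} (hM : 2 ≤ M.rank) {p : m → K} {q : n → K}
    (h : ∀ φ ψ, φ ⬝ᵥ p = 0 → ψ ⬝ᵥ q = 0 → φ ⬝ᵥ M *ᵥ ψ = 0) :
    p ∈ LinearMap.range M.mulVecLin ∧ M.rank = 2 := by
  obtain ⟨a, b, hab⟩ := exists_eq_vecMulVec_add_vecMulVec h
  have hle : LinearMap.range M.mulVecLin ≤ Submodule.span K (Set.range ![p, a]) := by
    rintro _ ⟨v, rfl⟩
    rw [mulVecLin_apply, hab, add_mulVec, vecMulVec_mulVec, vecMulVec_mulVec]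
    simp only [op_smul_eq_smul]
    exact add_mem (Submodule.smul_mem _ _ (Submodule.subset_span ⟨0, rfl⟩))
      (Submodule.smul_mem _ _ (Submodule.subset_span ⟨1, rfl⟩))
  have hspan : Module.finrank K (Submodule.span K (Set.range ![p, a])) ≤ 2 :=
    finrank_range_le_card ![p, a]
  have heq := Submodule.eq_of_le_of_finrank_le hle (hspan.trans hM)
  exact ⟨heq ▸ Submodule.subset_span ⟨0, rfl⟩,
    ((Submodule.finrank_mono hle).trans hspan).antisymm hM⟩

omit [Fintype m] in
theorem exists_eq_vecMulVec_of_rank_le_one {M : Matrix m n K} (hM : M.rank ≤ 1) :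
    ∃ a b, M = vecMulVec a b := by
  classical
  obtain ⟨⟨a, _⟩, ha⟩ := finrank_le_one_iff.1 hM
  choose b hb using fun j =>
    ha ⟨M.mulVecLin (Pi.single j 1), LinearMap.mem_range_self M.mulVecLin _⟩
  refine ⟨a, b, ext_iff.1 fun i j => ?_⟩
  have hcol := congrFun (congrArg Subtype.val (hb j)) i
  simpa [vecMulVec_apply, mul_comm, eq_comm] using hcol

omit [Fintype m] in
theorem det_ne_zero_of_card_le_rank [DecidableEq n] {M : Matrix n n K}
    (h : Fintype.card n ≤ M.rank) : M.det ≠ 0 := by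
  have htop : LinearMap.range M.mulVecLin = ⊤ := Submodule.eq_top_of_finrank_eq
    (M.rank_le_card_width.antisymm h |>.trans (Module.finrank_fintype_fun_eq_card K).symm)
  have hunit := mulVec_surjective_iff_isUnit.1 (LinearMap.range_eq_top.1 htop)
  exact ((isUnit_iff_isUnit_det _).1 hunit).ne_zero

end LinearAlgebra

section Symplectic

/-- The standard symplectic form on the plane: `v ⬝ᵥ J *ᵥ w` vanishes exactly when `v` and `w` are
proportional. -/
def J {R : Type*} [Ring R] : Matrix (Fin 2) (Fin 2) R := !![0, 1; -1, 0]

theorem J_mul_J {R : Type*} [Ring R] : (J * J : Matrix (Fin 2) (Fin 2) R) = -1 := by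
  ext i j
  fin_cases i <;> fin_cases j <;> simp [J]

theorem mul_J_mul_transpose {R : Type*} [CommRing R] (A : Matrix (Fin 2) (Fin 2) R) :
    A * J * Aᵀ = A.det • J := by
  ext i j
  fin_cases i <;> fin_cases j <;>
    simp only [J, Fin.zero_eta, Fin.isValue, Fin.mk_one, mul_apply, of_apply, cons_val',
      cons_val_fin_one, Fin.sum_univ_two, cons_val_zero, cons_val_one, transpose_apply,
      det_fin_two, Matrix.smul_apply, smul_eq_mul] <;> ring

theorem transpose_mul_J_mul {R : Type*} [CommRing R] (A : Matrix (Fin 2) (Fin 2) R) :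
    Aᵀ * J * A = A.det • J := by
  simpa using mul_J_mul_transpose Aᵀ

variable {K : Type*} [Field K]

theorem eq_smul_J {R : Type*} [Ring R] {N : Matrix (Fin 2) (Fin 2) R} (h₀₀ : N 0 0 = 0)
    (h₁₁ : N 1 1 = 0) (h₀₁ : N 0 1 + N 1 0 = 0) : N = N 0 1 • J := by
  ext i j
  fin_cases i <;> fin_cases j <;> simp [J, h₀₀, h₁₁, eq_neg_of_add_eq_zero_right h₀₁]

theorem eq_smul_of_transpose_mul_J_mul_eq {P N : Matrix (Fin 2) (Fin 2) K} (hP : P.det ≠ 0) {c : K}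
    (h : Pᵀ * J * N = c • J) : N = (P.det⁻¹ * c) • P := by
  have hdet : P.det • N = c • P := by
    have hPJ := congrArg (P * J * ·) h
    simp only [← Matrix.mul_assoc, mul_J_mul_transpose, Matrix.mul_smul, smul_mul] at hPJ
    simpa only [Matrix.mul_assoc, J_mul_J, Matrix.mul_neg, Matrix.mul_one, Matrix.neg_mul,
      Matrix.one_mul, smul_neg, neg_inj] using hPJ
  rw [mul_smul, ← hdet, inv_smul_smul₀ hP]

theorem quadratic_coeffs_eq_zero {R : Type*} [CommRing R] [IsDomain R] [Infinite R]
    {a b c p q : R} (hpq : ¬(p = 0 ∧ q = 0))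
    (h : ∀ t, p * t + q ≠ 0 → a * t ^ 2 + b * t + c = 0) : a = 0 ∧ b = 0 ∧ c = 0 := by
  have hprod : (Polynomial.C p * Polynomial.X + Polynomial.C q) *
      (Polynomial.C a * Polynomial.X ^ 2 + Polynomial.C b * Polynomial.X + Polynomial.C c) = 0 := by
    refine Polynomial.funext fun t => ?_
    by_cases ht : p * t + q = 0
    · simp [ht]
    · simp [h t ht]
  rcases mul_eq_zero.1 hprod with h₀ | h₀
  · have h₁ := congrArg (Polynomial.coeff · 1) h₀
    have h₂ := congrArg (Polynomial.coeff · 0) h₀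
    exact absurd (by simpa using And.intro h₁ h₂) hpq
  · simpa using And.intro (congrArg (Polynomial.coeff · 2) h₀)
      (And.intro (congrArg (Polynomial.coeff · 1) h₀) (congrArg (Polynomial.coeff · 0) h₀))

theorem exists_eq_smul_of_forall_dotProduct_mulVec_eq_zero [Infinite K]
    {P N : Matrix (Fin 2) (Fin 2) K} (hP : P.det ≠ 0)
    (h : ∀ s t : K, (P *ᵥ ![t, 1]) 0 ≠ 0 → ![s, 1] ⬝ᵥ P *ᵥ ![t, 1] = 0 →
      ![s, 1] ⬝ᵥ N *ᵥ ![t, 1] = 0) : ∃ c : K, N = c • P := by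
  have heval : ∀ (A : Matrix (Fin 2) (Fin 2) K) (s t : K), ![s, 1] ⬝ᵥ A *ᵥ ![t, 1] =
      s * (A 0 0 * t + A 0 1) + (A 1 0 * t + A 1 1) := fun A s t => by
    simp [mulVec, dotProduct, Fin.sum_univ_two]
  let F := Pᵀ * J * N
  have hF : ∀ t, P 0 0 * t + P 0 1 ≠ 0 → F 0 0 * t ^ 2 + (F 0 1 + F 1 0) * t + F 1 1 = 0 := by
    intro t h₀
    obtain ⟨s, hs⟩ : ∃ s, s * (P 0 0 * t + P 0 1) + (P 1 0 * t + P 1 1) = 0 :=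
      ⟨-(P 1 0 * t + P 1 1) / (P 0 0 * t + P 0 1), by rw [div_mul_cancel₀ _ h₀, neg_add_cancel]⟩
    have hN := h s t (by simpa [mulVec, dotProduct, Fin.sum_univ_two] using h₀) (by rw [heval, hs])
    rw [heval] at hN
    simp only [F, J, mul_apply, Fin.sum_univ_two, transpose_apply, of_apply, cons_val_zero,
      cons_val_one]
    linear_combination (P 0 0 * t + P 0 1) * hN - (N 0 0 * t + N 0 1) * hs
  obtain ⟨h₀₀, h₀₁, h₁₁⟩ := quadratic_coeffs_eq_zero
    (fun h₀ => hP (by rw [det_fin_two, h₀.1, h₀.2, zero_mul, zero_mul, sub_zero])) hF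
  exact ⟨_, eq_smul_of_transpose_mul_J_mul_eq hP (eq_smul_J h₀₀ h₁₁ h₀₁)⟩

theorem exists_quadratic_root [IsAlgClosed K] {a : K} (ha : a ≠ 0) (b c : K) :
    ∃ x, a * x ^ 2 + b * x + c = 0 := by
  obtain ⟨x, hx⟩ := IsAlgClosed.exists_root
    (Polynomial.C a * Polynomial.X ^ 2 + Polynomial.C b * Polynomial.X + Polynomial.C c)
    (by rw [Polynomial.degree_quadratic ha]; exact two_ne_zero)
  exact ⟨x, by simpa using hx⟩

theorem eq_smul_J_of_sum_eq_zero [IsAlgClosed K] {S : Type*} [CommRing S] [IsDomain S] [Algebra K S]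
    {ξ : Fin 2 → S} (hξ : LinearIndependent K ξ) {N : Matrix (Fin 2) (Fin 2) K}
    (h : ∑ i, ∑ j, N i j • (ξ i * ξ j) = 0) : ∃ c : K, N = c • J := by
  have hind := LinearIndependent.pair_iff.1 (show LinearIndependent K ![ξ 0, ξ 1] by
    convert hξ using 1; ext i; fin_cases i <;> rfl)
  simp only [Fin.sum_univ_two] at h
  have h₀₀ : N 0 0 = 0 := by
    by_contra hne
    obtain ⟨t, ht⟩ := exists_quadratic_root hne (N 0 1 + N 1 0) (N 1 1)
    have hfactor : (ξ 0 - t • ξ 1) * (N 0 0 • ξ 0 + (N 0 0 * t + N 0 1 + N 1 0) • ξ 1) = 0 := by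
      have ht' := congrArg (algebraMap K S) ht
      simp only [Algebra.smul_def, map_add, map_mul, map_pow, map_zero] at h ht' ⊢
      linear_combination h - ξ 1 ^ 2 * ht'
    rcases mul_eq_zero.1 hfactor with h0 | h0
    · exact one_ne_zero (hind 1 (-t) (by rw [one_smul, neg_smul, ← sub_eq_add_neg, h0])).1
    · exact hne (hind _ _ h0).1
  have hfactor : ξ 1 * ((N 0 1 + N 1 0) • ξ 0 + N 1 1 • ξ 1) = 0 := by
    simp only [h₀₀, Algebra.smul_def, map_add, map_zero] at h ⊢
    linear_combination h
  obtain ⟨hmixed, h₁₁⟩ := hind _ _ ((mul_eq_zero.1 hfactor).resolve_left (hξ.ne_zero 1))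
  exact ⟨N 0 1, eq_smul_J h₀₀ h₁₁ hmixed⟩

end Symplectic

section Pderiv

variable {σ R : Type*} [CommRing R] [IsDomain R] [CharZero R] {p : MvPolynomial σ R} {i j : σ}

omit [IsDomain R] [CharZero R] in
theorem degreeOf_pderiv_lt (h : 0 < p.degreeOf i) : (pderiv i p).degreeOf i < p.degreeOf i := by
  classical
  refine (degreeOf_lt_iff h).2 fun m hm => ?_
  have hm' : m + Finsupp.single i 1 ∈ p.support := by
    rw [mem_support_iff, coeff_pderiv] at hm
    exact mem_support_iff.2 (left_ne_zero_of_mul hm)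
  have hle := monomial_le_degreeOf i hm'
  rw [Finsupp.add_apply, Finsupp.single_eq_same] at hle
  omega

theorem pderiv_ne_zero (h : 0 < p.degreeOf i) : pderiv i p ≠ 0 := by
  classical
  intro h₀
  refine h.ne' (Nat.le_zero.1 (degreeOf_le_iff.2 fun m hm => ?_))
  by_contra hmi
  have hcoeff := congrArg (coeff (m - Finsupp.single i 1)) h₀
  rw [coeff_pderiv, coeff_zero, tsub_add_cancel_of_le (Finsupp.single_le_iff.2 (by omega))]
    at hcoeff
  exact (mul_ne_zero (mem_support_iff.1 hm) (Nat.cast_add_one_ne_zero _)) hcoeff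

theorem not_dvd_pderiv (h : 0 < p.degreeOf i) : ¬p ∣ pderiv i p := by
  rintro ⟨q, hq⟩
  have hpq : p * q ≠ 0 := hq ▸ pderiv_ne_zero h
  have hlt := degreeOf_pderiv_lt h
  rw [hq, degreeOf_mul_eq (left_ne_zero_of_mul hpq) (right_ne_zero_of_mul hpq)] at hlt
  omega

theorem mul_pderiv_pderiv_ne [UniqueFactorizationMonoid R] (hp : Irreducible p)
    (hi : 0 < p.degreeOf i) (hj : 0 < p.degreeOf j) :
    p * pderiv i (pderiv j p) ≠ pderiv i p * pderiv j p := fun h =>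
  (hp.prime.dvd_or_dvd ⟨_, h.symm⟩).elim (not_dvd_pderiv hi) (not_dvd_pderiv hj)

end Pderiv

section Chart

variable {R : Type*} [CommRing R]

/-- The Segre embedding of pairs of homogeneous coordinates on two projective lines. -/
def segre (ξ ζ : Fin 2 → R) : Fin 2 × Fin 2 → R := fun I => ξ I.1 * ζ I.2

/-- The vector `(x z, x, z, 1)` of multi-affine monomials in a pair of opposite variables. -/
def chart (x z : R) : Fin 2 × Fin 2 → R := segre ![x, 1] ![z, 1]

/-- The multi-affine polynomial in two variables with coefficient vector `p`, read as a bilinear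
form in the homogeneous coordinates `(x : 1)` and `(z : 1)`. -/
def toSquare (p : Fin 2 × Fin 2 → R) : Matrix (Fin 2) (Fin 2) R := of fun i j => p (i, j)

theorem segre_dotProduct (ξ ζ : Fin 2 → R) (p : Fin 2 × Fin 2 → R) :
    segre ξ ζ ⬝ᵥ p = ξ ⬝ᵥ toSquare p *ᵥ ζ := by
  simp only [dotProduct, mulVec, segre, toSquare, of_apply, Fintype.sum_prod_type, Finset.mul_sum]
  exact Finset.sum_congr rfl fun i _ => Finset.sum_congr rfl fun j _ => by ring

end Chart

section CoeffMatrix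

variable {R S : Type*} [CommRing R] [CommRing S]

/-- Regrouping four binary indices into two pairs. -/
def pairsEquiv : (Fin 2 × Fin 2) × (Fin 2 × Fin 2) ≃ (Fin 4 → Fin 2) where
  toFun p := ![p.1.1, p.2.1, p.1.2, p.2.2]
  invFun s := ((s 0, s 2), (s 1, s 3))
  left_inv _ := rfl
  right_inv s := by ext i; fin_cases i <;> rfl

/-- The multi-affine exponent vector whose entries are `1` where `s` is `0` and vice versa, so that
the index `0` always refers to the numerator of a homogeneous coordinate `(x : 1)`. -/
noncomputable def expo (s : Fin 4 → Fin 2) : Fin 4 →₀ ℕ :=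
  Finsupp.equivFunOnFinite.symm fun i => (s i).rev

theorem expo_injective : Function.Injective expo := fun s t h => by
  funext i
  exact Fin.rev_injective (Fin.ext (DFunLike.congr_fun h i))

/-- The coefficients of a multi-affine polynomial in four variables `x, y, z, w`; rows correspond to
monomials in `x, z` and columns to monomials in `y, w`. -/
noncomputable def coeffMatrix (Q : MvPolynomial (Fin 4) R) :
    Matrix (Fin 2 × Fin 2) (Fin 2 × Fin 2) R :=
  of fun I J => Q.coeff (expo (pairsEquiv (I, J)))

theorem sum_support_eq_sum_coeffMatrix {A : Type*} [AddCommMonoid A] {Q : MvPolynomial (Fin 4) R}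
    (hQ : ∀ i, Q.degreeOf i ≤ 1) (f : (Fin 4 →₀ ℕ) → R → A) (hf : ∀ m, f m 0 = 0) :
    ∑ m ∈ Q.support, f m (Q.coeff m) =
      ∑ I, ∑ J, f (expo (pairsEquiv (I, J))) (coeffMatrix Q I J) := by
  classical
  simp only [coeffMatrix, of_apply]
  rw [← Fintype.sum_prod_type', pairsEquiv.sum_comp (fun s => f (expo s) (Q.coeff (expo s))),
    ← Finset.sum_image (s := Finset.univ) (g := expo) (f := fun m => f m (Q.coeff m))
      (fun _ _ _ _ h => expo_injective h)]
  refine Finset.sum_subset (fun m hm => Finset.mem_image.2 ⟨fun i => Fin.rev ⟨m i, ?_⟩,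
    Finset.mem_univ _, ?_⟩) fun m _ hm => by rw [notMem_support_iff.1 hm, hf]
  · exact Nat.lt_succ_of_le ((monomial_le_degreeOf i hm).trans (hQ i))
  · ext i
    simp [expo]

theorem prod_pow_expo (I J : Fin 2 × Fin 2) (v w : Fin 4 → S) :
    ∏ i, v i ^ expo (pairsEquiv (I, J)) i * w i ^ (1 - expo (pairsEquiv (I, J)) i) =
      segre ![v 0, w 0] ![v 2, w 2] I * segre ![v 1, w 1] ![v 3, w 3] J := by
  have hpow : ∀ (i : Fin 4) (k : Fin 2),
      v i ^ (k.rev : ℕ) * w i ^ (1 - (k.rev : ℕ)) = ![v i, w i] k := fun i k => by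
    fin_cases k <;> simp
  simp only [expo, Finsupp.equivFunOnFinite_symm_apply_apply, hpow, Fin.prod_univ_four, segre]
  change ![v 0, w 0] I.1 * ![v 1, w 1] J.1 * ![v 2, w 2] I.2 * ![v 3, w 3] J.2 = _
  ring

theorem sum_sum_C_mul (M : Matrix (Fin 2 × Fin 2) (Fin 2 × Fin 2) R) {σ : Type*}
    (p q : Fin 2 × Fin 2 → MvPolynomial σ R) :
    ∑ I, ∑ J, C (M I J) * (p I * q J) = p ⬝ᵥ M.map C *ᵥ q := by
  simp only [dotProduct, mulVec, Finset.mul_sum, map_apply]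
  exact Finset.sum_congr rfl fun I _ => Finset.sum_congr rfl fun J _ => by ring

/-- The multi-affine polynomial in `x, y, z, w` with coefficient matrix `M`, inverse to
`coeffMatrix`. -/
noncomputable def multiaffine (M : Matrix (Fin 2 × Fin 2) (Fin 2 × Fin 2) R) :
    MvPolynomial (Fin 4) R :=
  chart (X 0) (X 2) ⬝ᵥ M.map C *ᵥ chart (X 1) (X 3)

theorem multiaffine_coeffMatrix {Q : MvPolynomial (Fin 4) R} (hQ : ∀ i, Q.degreeOf i ≤ 1) :
    multiaffine (coeffMatrix Q) = Q := by
  have hmon : ∀ (m : Fin 4 →₀ ℕ) (c : R), monomial m c =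
      C c * ∏ i, X i ^ m i * (1 : Fin 4 → MvPolynomial (Fin 4) R) i ^ (1 - m i) := fun m c => by
    rw [monomial_eq, Finsupp.prod_fintype _ _ fun _ => pow_zero _]
    simp only [Pi.one_apply, one_pow, mul_one]
  symm
  conv_lhs => rw [Q.as_sum, sum_support_eq_sum_coeffMatrix hQ (fun m c => monomial m c) (by simp)]
  simp only [hmon, prod_pow_expo, sum_sum_C_mul]
  rfl

variable (M : Matrix (Fin 2 × Fin 2) (Fin 2 × Fin 2) R)

theorem eval_multiaffine (v : Fin 4 → R) :
    eval v (multiaffine M) = chart (v 0) (v 2) ⬝ᵥ M *ᵥ chart (v 1) (v 3) := by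
  simp [multiaffine, dotProduct, mulVec, Fintype.sum_prod_type, chart, segre]

theorem eval_pderiv_zero_multiaffine (v : Fin 4 → R) :
    eval v (pderiv 0 (multiaffine M)) =
      segre ![1, 0] ![v 2, 1] ⬝ᵥ M *ᵥ chart (v 1) (v 3) := by
  simp only [multiaffine, dotProduct, chart, segre, mulVec, map_apply, Fintype.sum_prod_type,
    Fin.sum_univ_two, cons_val_zero, cons_val_one, cons_val_fin_one, mul_one, one_mul, map_add,
    Derivation.leibniz, pderiv_X, ne_eq, Fin.reduceEq, not_false_eq_true, Pi.single_eq_of_ne,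
    smul_eq_mul, mul_zero, one_ne_zero, add_zero, derivation_C, Pi.single_eq_same, zero_add,
    map_mul, eval_C, eval_X, zero_mul, add_left_inj]
  ring

theorem eval_pderiv_one_multiaffine (v : Fin 4 → R) :
    eval v (pderiv 1 (multiaffine M)) =
      chart (v 0) (v 2) ⬝ᵥ M *ᵥ segre ![1, 0] ![v 3, 1] := by
  simp [multiaffine, dotProduct, mulVec, Fintype.sum_prod_type, chart, segre, pderiv_X]

/-- The determinant of the bilinear form in `(x : 1)` and `(z : 1)` that the multi-affine polynomial
with coefficient matrix `M` defines at given values of `y` and `w`, as a polynomial in `y, w`. -/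
noncomputable def detPoly : MvPolynomial (Fin 2) R :=
  (toSquare (M.map C *ᵥ chart (X 0) (X 1))).det

theorem eval_detPoly (v : Fin 2 → R) :
    eval v (detPoly M) = (toSquare (M *ᵥ chart (v 0) (v 1))).det := by
  simp [detPoly, det_fin_two, toSquare, mulVec, dotProduct, Fintype.sum_prod_type, chart, segre]

theorem multiaffine_mul_pderiv_zero_two :
    multiaffine M * pderiv 0 (pderiv 2 (multiaffine M)) =
      pderiv 0 (multiaffine M) * pderiv 2 (multiaffine M) + rename ![1, 3] (detPoly M) := by
  simp only [multiaffine, dotProduct, chart, segre, Fin.isValue, mulVec, map_apply,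
    Fintype.sum_prod_type, Fin.sum_univ_two, cons_val_zero, cons_val_one, cons_val_fin_one, mul_one,
    one_mul, map_add, Derivation.leibniz, pderiv_X, ne_eq, Fin.reduceEq, not_false_eq_true,
    Pi.single_eq_of_ne, smul_eq_mul, mul_zero, add_zero, derivation_C, Pi.single_eq_same, zero_add,
    one_ne_zero, Nat.succ_eq_add_one, Nat.reduceAdd, detPoly, toSquare, det_fin_two, of_apply,
    map_sub, map_mul, algHom_C, algebraMap_eq, rename_X]
  ring

theorem multiaffine_mul_pderiv_one_three :
    multiaffine M * pderiv 1 (pderiv 3 (multiaffine M)) =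
      pderiv 1 (multiaffine M) * pderiv 3 (multiaffine M) + rename ![0, 2] (detPoly Mᵀ) := by
  simp only [multiaffine, dotProduct, chart, segre, Fin.isValue, mulVec, map_apply,
    Fintype.sum_prod_type, Fin.sum_univ_two, cons_val_zero, cons_val_one, cons_val_fin_one, mul_one,
    one_mul, map_add, Derivation.leibniz, pderiv_X, Pi.single_eq_same, smul_eq_mul, ne_eq,
    Fin.reduceEq, not_false_eq_true, Pi.single_eq_of_ne, mul_zero, add_zero, derivation_C,
    zero_ne_one, zero_add, Nat.succ_eq_add_one, Nat.reduceAdd, detPoly, toSquare, transpose_apply,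
    det_fin_two, of_apply, map_sub, map_mul, algHom_C, algebraMap_eq, rename_X]
  ring

theorem multiaffine_vecMulVec_mul_pderiv_zero_one (a b : Fin 2 × Fin 2 → R) :
    multiaffine (vecMulVec a b) * pderiv 0 (pderiv 1 (multiaffine (vecMulVec a b))) =
      pderiv 0 (multiaffine (vecMulVec a b)) * pderiv 1 (multiaffine (vecMulVec a b)) := by
  simp only [multiaffine, dotProduct, chart, segre, Fin.isValue, mulVec, map_apply, vecMulVec_apply,
    C_mul, Fintype.sum_prod_type, Fin.sum_univ_two, cons_val_zero, cons_val_one, cons_val_fin_one,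
    mul_one, one_mul, map_add, Derivation.leibniz, pderiv_X, ne_eq, Fin.reduceEq, not_false_eq_true,
    Pi.single_eq_of_ne, smul_eq_mul, mul_zero, Pi.single_eq_same, zero_add, derivation_C, add_zero,
    zero_ne_one, one_ne_zero]
  ring

end CoeffMatrix

section Nondegenerate

variable {K : Type*} [Field K]

/-- The properties of the coefficient matrix of an irreducible multi-affine polynomial, depending on
all its variables, on which the classification rests. -/
structure Nondegenerate (M : Matrix (Fin 2 × Fin 2) (Fin 2 × Fin 2) K) : Prop where
  two_le_rank : 2 ≤ M.rank
  detPoly_ne_zero : detPoly M ≠ 0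
  detPoly_transpose_ne_zero : detPoly Mᵀ ≠ 0

theorem nondegenerate_coeffMatrix [CharZero K] {Q : MvPolynomial (Fin 4) K} (hQ : Irreducible Q)
    (hdeg : ∀ i, Q.degreeOf i = 1) : Nondegenerate (coeffMatrix Q) := by
  obtain ⟨M, hM⟩ : ∃ M, M = coeffMatrix Q := ⟨_, rfl⟩
  obtain rfl : multiaffine M = Q := hM ▸ multiaffine_coeffMatrix fun i => (hdeg i).le
  have hne := fun i j => mul_pderiv_pderiv_ne hQ (i := i) (j := j) (by simp [hdeg]) (by simp [hdeg])
  rw [← hM]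
  refine ⟨?_, fun h => hne 0 2 ?_, fun h => hne 1 3 ?_⟩
  · by_contra! hrank
    obtain ⟨a, b, rfl⟩ := exists_eq_vecMulVec_of_rank_le_one (Nat.lt_succ_iff.1 hrank)
    exact hne 0 1 (multiaffine_vecMulVec_mul_pderiv_zero_one a b)
  · rw [multiaffine_mul_pderiv_zero_two, h, map_zero, add_zero]
  · rw [multiaffine_mul_pderiv_one_three, h, map_zero, add_zero]

end Nondegenerate

section Generic

variable {R : Type*} [CommRing R]

theorem eval_chart_dotProduct_C (v : Fin 2 → R) (p : Fin 2 × Fin 2 → R) :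
    eval v (chart (X 0) (X 1) ⬝ᵥ (C ∘ p)) = chart (v 0) (v 1) ⬝ᵥ p := by
  simp [dotProduct, chart, segre, Fintype.sum_prod_type]

theorem eq_zero_of_chart_dotProduct_C_eq_zero {p : Fin 2 × Fin 2 → R}
    (hp : chart (X 0) (X 1) ⬝ᵥ (C ∘ p) = (0 : MvPolynomial (Fin 2) R)) : p = 0 := by
  have heval : ∀ x z, chart x z ⬝ᵥ p = 0 := fun x z => by
    simpa only [eval_chart_dotProduct_C, map_zero, cons_val_zero, cons_val_one]
      using congrArg (eval ![x, z]) hp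
  simp only [dotProduct, chart, segre, Fintype.sum_prod_type, Fin.sum_univ_two, cons_val_zero,
    cons_val_one, mul_one, one_mul] at heval
  have h₁₁ : p (1, 1) = 0 := by simpa using heval 0 0
  have h₀₁ : p (0, 1) = 0 := by simpa [h₁₁] using heval 1 0
  have h₁₀ : p (1, 0) = 0 := by simpa [h₁₁] using heval 0 1
  have h₀₀ : p (0, 0) = 0 := by simpa [h₁₁, h₀₁, h₁₀] using heval 1 1
  ext ⟨i, j⟩
  fin_cases i <;> fin_cases j <;> assumption

variable [IsDomain R] [Infinite R]

theorem eq_zero_of_forall_eval_eq_zero {σ : Type*} {D p : MvPolynomial σ R} (hD : D ≠ 0)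
    (h : ∀ v, eval v D ≠ 0 → eval v p = 0) : p = 0 := by
  refine (mul_eq_zero.1 (MvPolynomial.funext fun v => ?_ : D * p = 0)).resolve_left hD
  by_cases hv : eval v D = 0
  · rw [map_mul, hv, zero_mul, map_zero]
  · rw [map_mul, h v hv, mul_zero, map_zero]

theorem exists_eval_ne_zero {σ : Type*} {D : MvPolynomial σ R} (hD : D ≠ 0) :
    ∃ v, eval v D ≠ 0 := by
  by_contra! h
  exact hD (MvPolynomial.funext fun v => by rw [h v, map_zero])

theorem eq_top_of_forall_chart_mem {K : Type*} [Field K] [Infinite K]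
    {V : Submodule K (Fin 2 × Fin 2 → K)} {D : MvPolynomial (Fin 2) K} (hD : D ≠ 0)
    (h : ∀ v, eval v D ≠ 0 → chart (v 0) (v 1) ∈ V) : V = ⊤ := by
  by_contra hV
  obtain ⟨f, hf, hVf⟩ := Submodule.exists_le_ker_of_lt_top V (lt_top_iff_ne_top.2 hV)
  obtain ⟨p, hfp⟩ : ∃ p : Fin 2 × Fin 2 → K, ∀ w, f w = w ⬝ᵥ p :=
    ⟨_, fun w => f.pi_apply_eq_sum_univ w⟩
  have hp : p = 0 := eq_zero_of_chart_dotProduct_C_eq_zero <|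
    eq_zero_of_forall_eval_eq_zero hD fun v hv => by
      rw [eval_chart_dotProduct_C, ← hfp]
      exact hVf (h v hv)
  exact hf (LinearMap.ext fun w => by rw [hfp, hp, dotProduct_zero, LinearMap.zero_apply])

end Generic

section Consistency

/-- Consistency of three equations with coefficient matrices `M₁`, `M₂`, `M₃` in the pairs of
variables `(x, y)`, `(y, z)`, `(z, x)`: solving the first one for `x` and the second one for `z`
produces a solution of the third one. -/
def Consistent {R : Type*} [CommRing R]
    (M₁ M₂ M₃ : Matrix (Fin 2 × Fin 2) (Fin 2 × Fin 2) R) : Prop :=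
  ∀ x x' y y' z z' : R, segre ![1, 0] ![x', 1] ⬝ᵥ M₁ *ᵥ chart y y' ≠ 0 →
    segre ![1, 0] ![z', 1] ⬝ᵥ M₂ᵀ *ᵥ chart y y' ≠ 0 →
    chart x x' ⬝ᵥ M₁ *ᵥ chart y y' = 0 → chart z z' ⬝ᵥ M₂ᵀ *ᵥ chart y y' = 0 →
      chart z z' ⬝ᵥ M₃ *ᵥ chart x x' = 0

variable {K : Type*} [Field K] [Infinite K]

theorem exists_eq_smul_of_forall_chart_dotProduct_eq_zero {p q : Fin 2 × Fin 2 → K}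
    (hp : (toSquare p).det ≠ 0)
    (h : ∀ x z, segre ![1, 0] ![z, 1] ⬝ᵥ p ≠ 0 → chart x z ⬝ᵥ p = 0 → chart x z ⬝ᵥ q = 0) :
    ∃ c : K, q = c • p := by
  obtain ⟨c, hc⟩ := exists_eq_smul_of_forall_dotProduct_mulVec_eq_zero hp (N := toSquare q)
    fun s t h₀ h₁ => by
      rw [← segre_dotProduct] at h₁ ⊢
      exact h s t (by simpa [segre_dotProduct] using h₀) h₁
  exact ⟨c, funext fun I => congrFun (congrFun hc I.1) I.2⟩

variable {M₁ M₂ M₃ : Matrix (Fin 2 × Fin 2) (Fin 2 × Fin 2) K}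

theorem Consistent.dotProduct_mulVec_eq_zero (h : Consistent M₁ M₂ M₃) {y y' : K}
    (h₁ : (toSquare (M₁ *ᵥ chart y y')).det ≠ 0) (h₂ : (toSquare (M₂ᵀ *ᵥ chart y y')).det ≠ 0)
    {φ ψ : Fin 2 × Fin 2 → K} (hφ : φ ⬝ᵥ M₁ *ᵥ chart y y' = 0)
    (hψ : ψ ⬝ᵥ M₂ᵀ *ᵥ chart y y' = 0) : ψ ⬝ᵥ M₃ *ᵥ φ = 0 := by
  obtain ⟨c, hc⟩ : ∃ c : K, M₃ *ᵥ φ = c • M₂ᵀ *ᵥ chart y y' :=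
    exists_eq_smul_of_forall_chart_dotProduct_eq_zero h₂ fun z z' d₂ e₂ => by
      obtain ⟨c, hc⟩ : ∃ c : K, chart z z' ᵥ* M₃ = c • M₁ *ᵥ chart y y' :=
        exists_eq_smul_of_forall_chart_dotProduct_eq_zero h₁ fun x x' d₁ e₁ => by
          rw [dotProduct_comm, ← dotProduct_mulVec]
          exact h x x' y y' z z' d₁ d₂ e₁ e₂
      rw [dotProduct_mulVec, hc, smul_dotProduct, dotProduct_comm, hφ, smul_zero]
  rw [hc, dotProduct_smul, hψ, smul_zero]

theorem Consistent.range_le_and_rank_eq_two (h : Consistent M₁ M₂ M₃) (h₁ : Nondegenerate M₁)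
    (h₂ : Nondegenerate M₂) (h₃ : Nondegenerate M₃) :
    LinearMap.range M₁.mulVecLin ≤ LinearMap.range M₃ᵀ.mulVecLin ∧ M₃.rank = 2 := by
  have hgeneric : ∀ v, eval v (detPoly M₁ * detPoly M₂ᵀ) ≠ 0 →
      M₁ *ᵥ chart (v 0) (v 1) ∈ LinearMap.range M₃ᵀ.mulVecLin ∧ M₃ᵀ.rank = 2 := fun v hv => by
    rw [map_mul, mul_ne_zero_iff, eval_detPoly, eval_detPoly] at hv
    refine mem_range_and_rank_eq_two (M₃.rank_transpose.symm ▸ h₃.two_le_rank)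
      (q := M₂ᵀ *ᵥ chart (v 0) (v 1)) fun φ ψ hφ hψ => ?_
    rw [mulVec_transpose, dotProduct_comm, ← dotProduct_mulVec]
    exact h.dotProduct_mulVec_eq_zero hv.1 hv.2 hφ hψ
  have hne := mul_ne_zero h₁.detPoly_ne_zero h₂.detPoly_transpose_ne_zero
  obtain ⟨v, hv⟩ := exists_eval_ne_zero hne
  refine ⟨?_, M₃.rank_transpose ▸ (hgeneric v hv).2⟩
  rw [LinearMap.range_le_iff_comap]
  exact eq_top_of_forall_chart_mem hne fun v hv => (hgeneric v hv).1

theorem Consistent.range_eq_range_transpose (c₁ : Consistent M₁ M₂ M₃) (c₂ : Consistent M₂ M₃ M₁)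
    (h₁ : Nondegenerate M₁) (h₂ : Nondegenerate M₂) (h₃ : Nondegenerate M₃) :
    LinearMap.range M₁.mulVecLin = LinearMap.range M₃ᵀ.mulVecLin := by
  obtain ⟨hle, hM₃⟩ := c₁.range_le_and_rank_eq_two h₁ h₂ h₃
  have hM₁ := (c₂.range_le_and_rank_eq_two h₂ h₃ h₁).2
  exact Submodule.eq_of_le_of_finrank_eq hle (hM₁.trans (M₃.rank_transpose.trans hM₃).symm)

end Consistency

section Pencil

/-- The two projective types of pencils of bilinear forms on a pair of projective lines that contain
a nondegenerate form: a line meeting the quadric of forms of rank one in two points or in one. -/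
inductive PencilType
  | secant
  | tangent

variable {R S : Type*} [CommRing R] [CommRing S]

/-- Standard generators of a pencil of bilinear forms; at `(x : 1)` and `(z : 1)` they take the
values `x, z` for a secant pencil and `x + z, 1` for a tangent pencil. -/
def PencilType.form (T : PencilType) (ξ ζ : Fin 2 → R) : Fin 2 → R :=
  match T with
  | secant => ![ξ 0 * ζ 1, ξ 1 * ζ 0]
  | tangent => ![ξ 0 * ζ 1 + ξ 1 * ζ 0, ξ 1 * ζ 1]

/-- The coefficient vectors, as columns, of the standard generators of a pencil after the coordinate
changes `A` and `B` on the two projective lines. -/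
def PencilType.frame (T : PencilType) (A B : Matrix (Fin 2) (Fin 2) R) :
    Matrix (Fin 2 × Fin 2) (Fin 2) R :=
  of fun I => T.form (A.col I.1) (B.col I.2)

namespace PencilType

variable (T : PencilType) (A B : Matrix (Fin 2) (Fin 2) R)

theorem segre_vecMul_frame (ξ ζ : Fin 2 → R) :
    segre ξ ζ ᵥ* T.frame A B = T.form (A *ᵥ ξ) (B *ᵥ ζ) := by
  ext k
  cases T <;> fin_cases k <;>
    simp only [vecMul, dotProduct, segre, frame, form, Fin.isValue, col_apply, Fin.zero_eta,
      Fin.mk_one, of_apply, cons_val_zero, cons_val_one, cons_val_fin_one,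
      Fintype.sum_prod_type, Fin.sum_univ_two, mulVec] <;> ring

theorem map_frame (f : R →+* S) : (T.frame A B).map f = T.frame (A.map f) (B.map f) := by
  ext I k
  cases T <;> fin_cases k <;> simp [frame, form]

variable {A B}

theorem exists_mul_frame_eq_one (hA : IsUnit A.det) (hB : IsUnit B.det) :
    ∃ L : Matrix (Fin 2) (Fin 2 × Fin 2) R, L * T.frame A B = 1 := by
  obtain ⟨ξ, ζ, hone⟩ : ∃ ξ ζ : Fin 2 → Fin 2 → R,
      (of fun k => T.form (ξ k) (ζ k) : Matrix (Fin 2) (Fin 2) R) = 1 := by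
    cases T
    · exact ⟨![![1, 0], ![0, 1]], ![![0, 1], ![1, 0]], by
        ext i j; fin_cases i <;> fin_cases j <;> simp [form]⟩
    · exact ⟨![![1, 0], ![0, 1]], ![![0, 1], ![0, 1]], by
        ext i j; fin_cases i <;> fin_cases j <;> simp [form]⟩
  refine ⟨of fun k => segre (A⁻¹ *ᵥ ξ k) (B⁻¹ *ᵥ ζ k), ?_⟩
  rw [← hone]
  refine funext fun k => ?_
  rw [mul_apply_eq_vecMul]
  change segre (A⁻¹ *ᵥ ξ k) (B⁻¹ *ᵥ ζ k) ᵥ* T.frame A B = T.form (ξ k) (ζ k)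
  rw [segre_vecMul_frame, mulVec_mulVec, mulVec_mulVec, mul_nonsing_inv A hA, mul_nonsing_inv B hB,
    one_mulVec, one_mulVec]

end PencilType

variable {K : Type*} [Field K] {V : Submodule K (Fin 2 × Fin 2 → K)}

theorem PencilType.range_frame_eq (T : PencilType) {A B : Matrix (Fin 2) (Fin 2) K}
    (hA : A.det ≠ 0) (hB : B.det ≠ 0) (hV : Module.finrank K V = 2)
    (hmem : ∀ k, (T.frame A B).col k ∈ V) : LinearMap.range (T.frame A B).mulVecLin = V := by
  obtain ⟨L, hL⟩ := T.exists_mul_frame_eq_one hA.isUnit hB.isUnit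
  have hrank : 2 ≤ (T.frame A B).rank := by
    have hle := rank_mul_le_right L (T.frame A B)
    rwa [hL, rank_one, Fintype.card_fin] at hle
  refine Submodule.eq_of_le_of_finrank_le ?_ (hV.trans_le hrank)
  rw [range_mulVecLin, Submodule.span_le]
  exact Set.range_subset_iff.2 hmem

theorem exists_eq_segre_of_det_eq_zero {N : Fin 2 × Fin 2 → K} (hN : (toSquare N).det = 0) :
    ∃ a b, N = segre a b := by
  obtain ⟨a, b, hab⟩ := exists_eq_vecMulVec_of_rank_le_one (M := toSquare N) <| by
    by_contra! hrank
    exact det_ne_zero_of_card_le_rank ((Fintype.card_fin 2).trans_le hrank) hN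
  exact ⟨a, b, funext fun I => congrFun (congrFun hab I.1) I.2⟩

theorem exists_segre_mem [IsAlgClosed K] (hV : Module.finrank K V = 2) {G : Fin 2 × Fin 2 → K}
    (hG : G ∈ V) (hdet : (toSquare G).det ≠ 0) : ∃ a b, a ≠ 0 ∧ b ≠ 0 ∧ segre a b ∈ V := by
  obtain ⟨H, hHV, hHG⟩ : ∃ H ∈ V, H ∉ Submodule.span K {G} := by
    refine SetLike.not_le_iff_exists.1 fun hle => ?_
    have hle_one := (Submodule.finrank_mono hle).trans (finrank_span_le_card {G})
    simp [hV] at hle_one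
  obtain ⟨t, ht⟩ := exists_quadratic_root hdet
    (G (0, 0) * H (1, 1) + G (1, 1) * H (0, 0) - G (0, 1) * H (1, 0) - G (1, 0) * H (0, 1))
    (toSquare H).det
  have hsingular : (toSquare (H + t • G)).det = 0 := by
    simp only [det_fin_two, toSquare, of_apply, Pi.add_apply, Pi.smul_apply, smul_eq_mul] at ht ⊢
    linear_combination ht
  obtain ⟨a, b, hab⟩ := exists_eq_segre_of_det_eq_zero hsingular
  have hne : segre a b ≠ 0 := fun h₀ => hHG <| by
    rw [eq_neg_of_add_eq_zero_left (hab.trans h₀), ← neg_smul]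
    exact Submodule.smul_mem _ _ (Submodule.mem_span_singleton_self G)
  refine ⟨a, b, ?_, ?_, hab ▸ V.add_mem hHV (V.smul_mem t hG)⟩
  · rintro rfl
    exact hne (funext fun I => zero_mul _)
  · rintro rfl
    exact hne (funext fun I => mul_zero _)

theorem exists_det_ne_zero_row_one_eq {a : Fin 2 → K} (ha : a ≠ 0) :
    ∃ A : Matrix (Fin 2) (Fin 2) K, A.det ≠ 0 ∧ A 1 = a := by
  obtain ⟨i, hi⟩ := Function.ne_iff.1 ha
  refine ⟨of ![Pi.single i.rev 1, a], ?_, rfl⟩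
  fin_cases i <;> simpa [det_fin_two] using hi

theorem exists_eq_sum_segre {A B : Matrix (Fin 2) (Fin 2) K} (hA : A.det ≠ 0) (hB : B.det ≠ 0)
    (G : Fin 2 × Fin 2 → K) : ∃ n : Matrix (Fin 2) (Fin 2) K,
      G = ∑ i, ∑ j, n i j • segre (A i) (B j) ∧ (toSquare G).det = A.det * n.det * B.det := by
  obtain ⟨n, hn⟩ : ∃ n, toSquare G = Aᵀ * n * B := ⟨Aᵀ⁻¹ * toSquare G * B⁻¹, by
    rw [← Matrix.mul_assoc, Matrix.mul_assoc, mul_nonsing_inv_cancel_left _ _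
      (A.det_transpose ▸ hA.isUnit), nonsing_inv_mul _ hB.isUnit, Matrix.mul_one]⟩
  refine ⟨n, funext fun I => ?_, by rw [hn, det_mul, det_mul, det_transpose]⟩
  have hI := congrFun (congrFun hn I.1) I.2
  simp only [toSquare, of_apply, mul_apply, transpose_apply, Fin.sum_univ_two] at hI
  simp only [Fin.sum_univ_two, Pi.add_apply, Pi.smul_apply, segre, smul_eq_mul]
  linear_combination hI

/-- The pencil `V` of bilinear forms is of type `T`: it is spanned by the standard generators in
suitable coordinates on the two projective lines. -/
def PencilType.IsTypeOf (T : PencilType) (V : Submodule K (Fin 2 × Fin 2 → K)) : Prop :=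
  ∃ A B : Matrix (Fin 2) (Fin 2) K, A.det ≠ 0 ∧ B.det ≠ 0 ∧
    LinearMap.range (T.frame A B).mulVecLin = V

section Normalization

variable {A B n : Matrix (Fin 2) (Fin 2) K}

theorem sub_smul_segre_mem (hG : ∑ i, ∑ j, n i j • segre (A i) (B j) ∈ V)
    (hab : segre (A 1) (B 1) ∈ V) (c : K) {v : Fin 2 × Fin 2 → K}
    (hv : v = ∑ i, ∑ j, n i j • segre (A i) (B j) - c • segre (A 1) (B 1)) : v ∈ V :=
  hv ▸ V.sub_mem hG (V.smul_mem c hab)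

theorem isTypeOf_tangent (hV : Module.finrank K V = 2) (hA : A.det ≠ 0) (hB : B.det ≠ 0)
    (hG : ∑ i, ∑ j, n i j • segre (A i) (B j) ∈ V) (hab : segre (A 1) (B 1) ∈ V)
    (h₀₀ : n 0 0 = 0) (h₀₁ : n 0 1 ≠ 0) (h₁₀ : n 1 0 ≠ 0) : PencilType.tangent.IsTypeOf V := by
  have hA' : (of ![n 0 1 • A 0, A 1]).det ≠ 0 := by
    convert mul_ne_zero h₀₁ hA using 1
    simp only [det_fin_two, of_apply, cons_val', Pi.smul_apply, smul_eq_mul, cons_val_fin_one,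
      cons_val_zero, cons_val_one]
    ring
  have hB' : (of ![n 1 0 • B 0, B 1]).det ≠ 0 := by
    convert mul_ne_zero h₁₀ hB using 1
    simp only [det_fin_two, of_apply, cons_val', Pi.smul_apply, smul_eq_mul, cons_val_fin_one,
      cons_val_zero, cons_val_one]
    ring
  refine ⟨_, _, hA', hB', PencilType.range_frame_eq _ hA' hB' hV fun k => ?_⟩
  fin_cases k
  · refine sub_smul_segre_mem hG hab (n 1 1) (funext fun I => ?_)
    simp only [PencilType.frame, PencilType.form, col_apply, of_apply, cons_val', Pi.add_apply,
      Pi.sub_apply, Pi.smul_apply, smul_eq_mul, cons_val_fin_one, cons_val_zero, cons_val_one,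
      Fin.zero_eta, Fin.sum_univ_two, segre, h₀₀, zero_smul, zero_add]
    ring
  · exact hab

theorem isTypeOf_secant (hV : Module.finrank K V = 2) (hA : A.det ≠ 0) (hB : B.det ≠ 0)
    (hG : ∑ i, ∑ j, n i j • segre (A i) (B j) ∈ V) (hab : segre (A 1) (B 1) ∈ V)
    (h₀₀ : n 0 0 ≠ 0) : PencilType.secant.IsTypeOf V := by
  have hA' : (of ![A 1, A 0 + (n 1 0 / n 0 0) • A 1]).det ≠ 0 := by
    convert neg_ne_zero.2 hA using 1
    simp only [det_fin_two, of_apply, cons_val', Pi.add_apply, Pi.smul_apply, smul_eq_mul,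
      cons_val_fin_one, cons_val_zero, cons_val_one]
    ring
  have hB' : (of ![n 0 0 • B 0 + n 0 1 • B 1, B 1]).det ≠ 0 := by
    convert mul_ne_zero h₀₀ hB using 1
    simp only [det_fin_two, of_apply, cons_val', Pi.add_apply, Pi.smul_apply, smul_eq_mul,
      cons_val_fin_one, cons_val_zero, cons_val_one]
    ring
  refine ⟨_, _, hA', hB', PencilType.range_frame_eq _ hA' hB' hV fun k => ?_⟩
  fin_cases k
  · exact hab
  · refine sub_smul_segre_mem hG hab (n 1 1 - n 1 0 * n 0 1 / n 0 0) (funext fun I => ?_)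
    simp only [PencilType.frame, PencilType.form, col_apply, of_apply, cons_val', Pi.add_apply,
      Pi.sub_apply, Pi.smul_apply, smul_eq_mul, cons_val_fin_one, cons_val_zero, cons_val_one,
      Fin.mk_one, Fin.sum_univ_two, segre]
    field_simp
    ring

end Normalization

theorem exists_isTypeOf [IsAlgClosed K] (hV : Module.finrank K V = 2) {G : Fin 2 × Fin 2 → K}
    (hG : G ∈ V) (hdet : (toSquare G).det ≠ 0) : ∃ T : PencilType, T.IsTypeOf V := by
  obtain ⟨a, b, ha, hb, hab⟩ := exists_segre_mem hV hG hdet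
  obtain ⟨A, hA, rfl⟩ := exists_det_ne_zero_row_one_eq ha
  obtain ⟨B, hB, rfl⟩ := exists_det_ne_zero_row_one_eq hb
  obtain ⟨n, rfl, hn⟩ := exists_eq_sum_segre hA hB G
  by_cases h₀₀ : n 0 0 = 0
  · obtain ⟨h₀₁, h₁₀⟩ : n 0 1 ≠ 0 ∧ n 1 0 ≠ 0 := mul_ne_zero_iff.1 fun h₀ => hdet <| by
      rw [hn, det_fin_two n, h₀₀, h₀, zero_mul, sub_zero, mul_zero, zero_mul]
    exact ⟨.tangent, isTypeOf_tangent hV hA hB hG hab h₀₀ h₀₁ h₁₀⟩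
  · exact ⟨.secant, isTypeOf_secant hV hA hB hG hab h₀₀⟩

end Pencil

section Factorization

theorem exists_eq_mul_of_range_le {K m n k : Type*} [CommSemiring K] [Fintype n] [Fintype k]
    {M : Matrix m n K} {P : Matrix m k K}
    (h : LinearMap.range M.mulVecLin ≤ LinearMap.range P.mulVecLin) :
    ∃ X : Matrix k n K, M = P * X := by
  classical
  choose x hx using fun j => h (LinearMap.mem_range_self M.mulVecLin (Pi.single j 1))
  refine ⟨(of x)ᵀ, ext_iff.1 fun i j => ?_⟩
  simpa [mul_apply, mulVec, dotProduct, Pi.single_apply] using (congrFun (hx j) i).symm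

theorem exists_eq_mul_mul_transpose {K m n k l : Type*} [CommRing K] [Fintype m] [Fintype n]
    [Fintype k] [Fintype l] [DecidableEq k] {M : Matrix m n K} {P : Matrix m k K}
    {Q : Matrix n l K} {L : Matrix k m K} (hL : L * P = 1)
    (hP : LinearMap.range M.mulVecLin ≤ LinearMap.range P.mulVecLin)
    (hQ : LinearMap.range Mᵀ.mulVecLin ≤ LinearMap.range Q.mulVecLin) :
    ∃ A : Matrix k l K, M = P * A * Qᵀ := by
  obtain ⟨X, hX⟩ := exists_eq_mul_of_range_le hP
  obtain ⟨Y, hY⟩ := exists_eq_mul_of_range_le hQ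
  refine ⟨L * Yᵀ, ?_⟩
  rw [Matrix.mul_assoc, Matrix.mul_assoc, ← transpose_mul, ← hY, transpose_transpose, hX,
    ← Matrix.mul_assoc L, hL, Matrix.one_mul]

variable {K : Type*} [Field K]

theorem Nondegenerate.det_ne_zero {P Q : Matrix (Fin 2 × Fin 2) (Fin 2) K}
    {A : Matrix (Fin 2) (Fin 2) K} (h : Nondegenerate (P * A * Qᵀ)) : A.det ≠ 0 := by
  refine det_ne_zero_of_card_le_rank (h.two_le_rank.trans ?_)
  exact (rank_mul_le_left _ _).trans (rank_mul_le_right _ _)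

theorem vecMul_dotProduct_mulVec {K m k : Type*} [CommSemiring K] [Fintype m] [Fintype k]
    [DecidableEq k] {P : Matrix m k K} {L : Matrix k m K} (hL : L * P = 1) (w x : k → K) :
    (w ᵥ* L) ⬝ᵥ P *ᵥ x = w ⬝ᵥ x := by
  rw [dotProduct_mulVec, vecMul_vecMul, hL, vecMul_one]

theorem transpose_J {R : Type*} [Ring R] : (J : Matrix (Fin 2) (Fin 2) R)ᵀ = -J := by
  ext i j
  fin_cases i <;> fin_cases j <;> simp [J]

theorem J_mulVec_dotProduct_self {R : Type*} [CommRing R] (v : Fin 2 → R) : (J *ᵥ v) ⬝ᵥ v = 0 := by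
  simp only [dotProduct, mulVec, J, of_apply, cons_val', cons_val_fin_one, Fin.sum_univ_two,
    cons_val_zero, cons_val_one, zero_mul, one_mul, zero_add, neg_mul, add_zero]
  ring

theorem linearIndependent_chart_vecMul {Q : Matrix (Fin 2 × Fin 2) (Fin 2) K}
    {L : Matrix (Fin 2) (Fin 2 × Fin 2) K} (hL : L * Q = 1) :
    LinearIndependent K (chart (X 0) (X 1) ᵥ* Q.map C : Fin 2 → MvPolynomial (Fin 2) K) := by
  refine Fintype.linearIndependent_iff.2 fun c hc => ?_
  have hQc : Q *ᵥ c = 0 := eq_zero_of_chart_dotProduct_C_eq_zero <| by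
    rw [← hc]
    have hcomp : (C ∘ (Q *ᵥ c) : _ → MvPolynomial (Fin 2) K) = Q.map C *ᵥ (C ∘ c) := by
      ext1 I
      simp [mulVec, dotProduct]
    rw [hcomp, dotProduct_mulVec]
    simp [dotProduct, smul_eq_C_mul, mul_comm]
  have hc₀ : c = 0 := by rw [← one_mulVec c, ← hL, ← mulVec_mulVec, hQc, mulVec_zero]
  exact congrFun hc₀

variable [IsAlgClosed K]

theorem exists_eq_smul_J_of_generic {Q : Matrix (Fin 2 × Fin 2) (Fin 2) K}
    {L : Matrix (Fin 2) (Fin 2 × Fin 2) K} (hL : L * Q = 1) {D : MvPolynomial (Fin 2) K}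
    (hD : D ≠ 0) {N : Matrix (Fin 2) (Fin 2) K}
    (h : ∀ v, eval v D ≠ 0 →
      (chart (v 0) (v 1) ᵥ* Q) ⬝ᵥ N *ᵥ (chart (v 0) (v 1) ᵥ* Q) = 0) : ∃ c : K, N = c • J := by
  refine eq_smul_J_of_sum_eq_zero (S := MvPolynomial (Fin 2) K)
    (linearIndependent_chart_vecMul hL) ?_
  refine eq_zero_of_forall_eval_eq_zero hD fun v hv => ?_
  have hcoord : ∀ k, eval v ((chart (X 0) (X 1) ᵥ* Q.map C) k) = (chart (v 0) (v 1) ᵥ* Q) k :=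
    fun k => eval_chart_dotProduct_C v (Q.col k)
  rw [← h v hv, map_sum]
  simp only [map_sum, smul_eval, map_mul, hcoord, dotProduct, mulVec, Finset.mul_sum]
  exact Finset.sum_congr rfl fun i _ => Finset.sum_congr rfl fun j _ => by ring

theorem Consistent.exists_eq_smul {P Q R : Matrix (Fin 2 × Fin 2) (Fin 2) K}
    {L L' L'' : Matrix (Fin 2) (Fin 2 × Fin 2) K} {A B D : Matrix (Fin 2) (Fin 2) K}
    (hP : L * P = 1) (hQ : L' * Q = 1) (hR : L'' * R = 1)
    (h : Consistent (P * A * Qᵀ) (Q * B * Rᵀ) (R * D * Pᵀ)) (h₁ : Nondegenerate (P * A * Qᵀ))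
    (h₂ : Nondegenerate (Q * B * Rᵀ)) (h₃ : Nondegenerate (R * D * Pᵀ)) :
    ∃ k : K, k ≠ 0 ∧ D = k • (Bᵀ * J * Aᵀ) := by
  obtain ⟨c, hc⟩ : ∃ c : K, (J * Bᵀ)ᵀ * D * (J * A) = c • J := by
    refine exists_eq_smul_J_of_generic hQ
      (mul_ne_zero h₁.detPoly_ne_zero h₂.detPoly_transpose_ne_zero) fun v hv => ?_
    rw [map_mul, mul_ne_zero_iff, eval_detPoly, eval_detPoly] at hv
    have key := h.dotProduct_mulVec_eq_zero hv.1 hv.2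
      (φ := (J *ᵥ A *ᵥ (chart (v 0) (v 1) ᵥ* Q)) ᵥ* L)
      (ψ := (J *ᵥ Bᵀ *ᵥ (chart (v 0) (v 1) ᵥ* Q)) ᵥ* L'') ?_ ?_
    · simp only [← mulVec_mulVec, mulVec_transpose P, vecMul_vecMul, hP, vecMul_one,
        vecMul_dotProduct_mulVec hR] at key
      simpa only [← mulVec_mulVec, dotProduct_mulVec _ (J * Bᵀ)ᵀ, vecMul_transpose] using key
    · simp only [← mulVec_mulVec, mulVec_transpose, vecMul_dotProduct_mulVec hP,
        J_mulVec_dotProduct_self]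
    · simp only [transpose_mul, transpose_transpose, ← mulVec_mulVec, mulVec_transpose,
        vecMul_dotProduct_mulVec hR, J_mulVec_dotProduct_self]
  have hD : (A.det * B.det) • D = c • (Bᵀ * J * Aᵀ) := calc
    (A.det * B.det) • D = Bᵀ * J * B * (J * D * J) * (A * J * Aᵀ) := by
      rw [transpose_mul_J_mul, mul_J_mul_transpose, smul_mul, smul_mul, Matrix.mul_smul, smul_smul,
        mul_comm B.det, ← Matrix.mul_assoc, ← Matrix.mul_assoc, J_mul_J, Matrix.mul_assoc, J_mul_J]
      simp
    _ = -(Bᵀ * J * ((J * Bᵀ)ᵀ * D * (J * A)) * J * Aᵀ) := by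
      simp [Matrix.mul_assoc, transpose_J]
    _ = c • (Bᵀ * J * Aᵀ) := by
      rw [hc, Matrix.mul_smul, Matrix.mul_assoc Bᵀ, J_mul_J]
      simp [Matrix.mul_assoc]
  have hdet := mul_ne_zero h₁.det_ne_zero h₂.det_ne_zero
  refine ⟨(A.det * B.det)⁻¹ * c, mul_ne_zero (inv_ne_zero hdet) ?_, ?_⟩
  · rintro rfl
    rw [zero_smul, smul_eq_zero_iff_right hdet] at hD
    exact h₃.det_ne_zero (by rw [hD, det_zero])
  · rw [mul_smul, ← hD, inv_smul_smul₀ hdet]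

end Factorization

section QuadEquation

variable {Q : MvPolynomial (Fin 4) ℂ} {f : Fin 4 → Fin 6}

theorem IsQuadEquation.multiaffine_coeffMatrix (hQ : IsQuadEquation Q) :
    multiaffine (coeffMatrix Q) = Q :=
  CAO.multiaffine_coeffMatrix fun i => (hQ.2 i).le

theorem IsQuadEquation.nondegenerate (hQ : IsQuadEquation Q) : Nondegenerate (coeffMatrix Q) :=
  nondegenerate_coeffMatrix hQ.1 hQ.2

theorem IsQuadEquation.mem_vars_rename_iff (hQ : IsQuadEquation Q) (hf : Function.Injective f)
    {i : Fin 6} : i ∈ (rename f Q).vars ↔ i ∈ Set.range f := by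
  constructor
  · intro hi
    obtain ⟨k, -, rfl⟩ := mem_vars_rename f Q hi
    exact Set.mem_range_self k
  · rintro ⟨k, rfl⟩
    rw [mem_vars_iff_degreeOf_ne_zero, degreeOf_rename_of_injective hf, hQ.2]
    exact one_ne_zero

theorem IsQuadEquation.eval_rename (hQ : IsQuadEquation Q) (f : Fin 4 → Fin 6) (v : Fin 6 → ℂ) :
    eval v (rename f Q) =
      chart (v (f 0)) (v (f 2)) ⬝ᵥ coeffMatrix Q *ᵥ chart (v (f 1)) (v (f 3)) := by
  conv_lhs => rw [← hQ.multiaffine_coeffMatrix]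
  exact (MvPolynomial.eval_rename ..).trans (eval_multiaffine ..)

theorem IsQuadEquation.eval_pderiv_zero_rename (hQ : IsQuadEquation Q) (hf : Function.Injective f)
    (v : Fin 6 → ℂ) : eval v (pderiv (f 0) (rename f Q)) =
      segre ![1, 0] ![v (f 2), 1] ⬝ᵥ coeffMatrix Q *ᵥ chart (v (f 1)) (v (f 3)) := by
  conv_lhs => rw [← hQ.multiaffine_coeffMatrix, pderiv_rename hf]
  exact (MvPolynomial.eval_rename ..).trans (eval_pderiv_zero_multiaffine ..)

theorem IsQuadEquation.eval_pderiv_one_rename (hQ : IsQuadEquation Q) (hf : Function.Injective f)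
    (v : Fin 6 → ℂ) : eval v (pderiv (f 1) (rename f Q)) =
      chart (v (f 0)) (v (f 2)) ⬝ᵥ coeffMatrix Q *ᵥ segre ![1, 0] ![v (f 3), 1] := by
  conv_lhs => rw [← hQ.multiaffine_coeffMatrix, pderiv_rename hf]
  exact (MvPolynomial.eval_rename ..).trans (eval_pderiv_one_multiaffine ..)

theorem IsQuadEquation.mobius_rename (hQ : IsQuadEquation Q) (hf : Function.Injective f)
    (r : Fin 6 → Matrix (Fin 2) (Fin 2) ℂ) :
    mobius r (rename f Q) =
      segre ((r (f 0)).map C *ᵥ ![u (f 0), 1]) ((r (f 2)).map C *ᵥ ![u (f 2), 1]) ⬝ᵥ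
        (coeffMatrix Q).map C *ᵥ
          segre ((r (f 1)).map C *ᵥ ![u (f 1), 1]) ((r (f 3)).map C *ᵥ ![u (f 3), 1]) := by
  classical
  have hmulVec : ∀ k, (r (f k)).map C *ᵥ ![u (f k), 1] =
      ![C (r (f k) 0 0) * u (f k) + C (r (f k) 0 1),
        C (r (f k) 1 0) * u (f k) + C (r (f k) 1 1)] := fun k => by
    ext i : 1
    fin_cases i <;> simp [mulVec, dotProduct]
  have hprod : ∀ m : Fin 4 →₀ ℕ,
      ∏ i, (C (r i 0 0) * u i + C (r i 0 1)) ^ (m.mapDomain f) i *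
        (C (r i 1 0) * u i + C (r i 1 1)) ^ ((rename f Q).degreeOf i - (m.mapDomain f) i) =
      ∏ k, (C (r (f k) 0 0) * u (f k) + C (r (f k) 0 1)) ^ m k *
        (C (r (f k) 1 0) * u (f k) + C (r (f k) 1 1)) ^ (1 - m k) := fun m => by
    refine (Fintype.prod_of_injective f hf _ _ (fun i hi => ?_) fun k => ?_).symm
    · have hdeg : (rename f Q).degreeOf i = 0 := by
        rwa [← hQ.mem_vars_rename_iff hf, mem_vars_iff_degreeOf_ne_zero, not_not] at hi
      rw [Finsupp.mapDomain_of_notMem_range _ _ hi, hdeg]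
      simp only [pow_zero, le_refl, tsub_eq_zero_of_le, mul_one]
    · rw [Finsupp.mapDomain_apply hf, degreeOf_rename_of_injective hf, hQ.2 k]
  rw [mobius, support_rename_of_injective hf,
    Finset.sum_image fun a _ b _ h => Finsupp.mapDomain_injective hf h]
  simp only [coeff_rename_mapDomain f hf, hprod]
  rw [sum_support_eq_sum_coeffMatrix (fun i => (hQ.2 i).le) (fun m c => C c *
    ∏ k, (C (r (f k) 0 0) * u (f k) + C (r (f k) 0 1)) ^ m k *
      (C (r (f k) 1 0) * u (f k) + C (r (f k) 1 1)) ^ (1 - m k)) (by simp)]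
  simp only [hmulVec, prod_pow_expo, sum_sum_C_mul]

end QuadEquation

section CAOConsistent

variable {Q₁ Q₂ Q₃ : MvPolynomial (Fin 4) ℂ}

theorem ObtainedFrom.symm {R P Q : MvPolynomial (Fin 6) ℂ} (h : ObtainedFrom R P Q) :
    ObtainedFrom R Q P := fun a ha b hb v hPa hQb hP hQ => h b hb a ha v hQb hPa hQ hP

theorem ObtainedFrom.consistent (h₁ : IsQuadEquation Q₁) (h₂ : IsQuadEquation Q₂)
    (h₃ : IsQuadEquation Q₃) {p : Fin 6 → Fin 6} (hp : Function.Injective p)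
    (h : ObtainedFrom (rename (p ∘ ![4, 0, 5, 1]) Q₃) (rename (p ∘ ![0, 2, 1, 3]) Q₁)
      (rename (p ∘ ![2, 4, 3, 5]) Q₂)) :
    Consistent (coeffMatrix Q₁) (coeffMatrix Q₂) (coeffMatrix Q₃) := by
  intro x x' y y' z z' d₁ d₂ e₁ e₂
  have hp₁ : Function.Injective (p ∘ ![0, 2, 1, 3]) := hp.comp (by decide)
  have hp₂ : Function.Injective (p ∘ ![2, 4, 3, 5]) := hp.comp (by decide)
  obtain ⟨v, hv⟩ : ∃ v : Fin 6 → ℂ, ∀ i, v (p i) = ![x, x', y, y', z, z'] i :=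
    ⟨Function.extend p ![x, x', y, y', z, z'] 0, hp.extend_apply _ _⟩
  obtain ⟨rfl, rfl, rfl, rfl, rfl, rfl⟩ : v (p 0) = x ∧ v (p 1) = x' ∧ v (p 2) = y ∧
    v (p 3) = y' ∧ v (p 4) = z ∧ v (p 5) = z' := ⟨hv 0, hv 1, hv 2, hv 3, hv 4, hv 5⟩
  have hsolve₁ : p 0 ∈ (rename (p ∘ ![0, 2, 1, 3]) Q₁).vars \
      (rename (p ∘ ![2, 4, 3, 5]) Q₂).vars := by
    simp only [Finset.mem_sdiff, h₁.mem_vars_rename_iff hp₁, h₂.mem_vars_rename_iff hp₂,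
      Set.mem_range, Function.comp_apply, hp.eq_iff]
    decide
  have hsolve₂ : p 4 ∈ (rename (p ∘ ![2, 4, 3, 5]) Q₂).vars \
      (rename (p ∘ ![0, 2, 1, 3]) Q₁).vars := by
    simp only [Finset.mem_sdiff, h₁.mem_vars_rename_iff hp₁, h₂.mem_vars_rename_iff hp₂,
      Set.mem_range, Function.comp_apply, hp.eq_iff]
    decide
  rw [dotProduct_transpose_mulVec] at d₂ e₂
  have hsol : eval v (rename (p ∘ ![4, 0, 5, 1]) Q₃) = 0 := by
    refine h (p 0) hsolve₁ (p 4) hsolve₂ v ?_ ?_ ?_ ?_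
    · have hpderiv := h₁.eval_pderiv_zero_rename hp₁ v
      exact hpderiv.trans_ne d₁
    · have hpderiv := h₂.eval_pderiv_one_rename hp₂ v
      exact hpderiv.trans_ne d₂
    · rw [h₁.eval_rename]
      exact e₁
    · rw [h₂.eval_rename]
      exact e₂
  rwa [h₃.eval_rename] at hsol

theorem HasCAO.consistent (h₁ : IsQuadEquation Q₁) (h₂ : IsQuadEquation Q₂)
    (h₃ : IsQuadEquation Q₃) (h : HasCAO (octahedron Q₁ Q₂ Q₃)) :
    Consistent (coeffMatrix Q₁) (coeffMatrix Q₂) (coeffMatrix Q₃) ∧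
      Consistent (coeffMatrix Q₂) (coeffMatrix Q₃) (coeffMatrix Q₁) ∧
      Consistent (coeffMatrix Q₃) (coeffMatrix Q₁) (coeffMatrix Q₂) := by
  obtain ⟨c₂, c₃, c₁⟩ := h
  refine ⟨ObtainedFrom.consistent (p := ![4, 1, 2, 5, 6, 3]) h₁ h₂ h₃ (by decide) ?_,
    ObtainedFrom.consistent (p := ![2, 5, 6, 3, 4, 1]) h₂ h₃ h₁ (by decide) ?_,
    ObtainedFrom.consistent (p := ![6, 3, 4, 1, 2, 5]) h₃ h₁ h₂ (by decide) ?_⟩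
  · convert c₁ using 3 <;> exact DFunLike.congr_fun (congrArg rename (by decide)) _
  · convert c₂ using 3 <;> exact DFunLike.congr_fun (congrArg rename (by decide)) _
  · convert c₃.symm using 3 <;> exact DFunLike.congr_fun (congrArg rename (by decide)) _

end CAOConsistent

section NormalForm

/-- The equation with coefficient matrix `A` in the standard generators of a pencil of type `s` in
the variables `f 0`, `f 2` and of one of type `t` in the variables `f 1`, `f 3`. -/
noncomputable def normalEquation (s t : PencilType) (A : Matrix (Fin 2) (Fin 2) ℂ)
    (f : Fin 4 → Fin 6) : MvPolynomial (Fin 6) ℂ :=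
  s.form ![u (f 0), 1] ![u (f 2), 1] ⬝ᵥ A.map C *ᵥ t.form ![u (f 1), 1] ![u (f 3), 1]

/-- The octahedron whose three equations are in normal form with respect to pencils of types `s₁`,
`s₂`, `s₃` on the pairs of opposite vertices `4,1`; `2,5`; `6,3`. The third coefficient matrix is
the one that consistency forces upon `A` and `B`. -/
noncomputable def normalSystem (s₁ s₂ s₃ : PencilType) (A B : Matrix (Fin 2) (Fin 2) ℂ) :
    Fin 3 → MvPolynomial (Fin 6) ℂ :=
  ![normalEquation s₁ s₂ A ![4, 2, 1, 5], normalEquation s₂ s₃ B ![2, 6, 5, 3],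
    normalEquation s₃ s₁ (Bᵀ * J * Aᵀ) ![6, 4, 3, 1]]

theorem normalEquation_smul (s t : PencilType) (c : ℂ) (A : Matrix (Fin 2) (Fin 2) ℂ)
    (f : Fin 4 → Fin 6) : normalEquation s t (c • A) f = C c * normalEquation s t A f := by
  have hmap : (c • A).map C = (C c : MvPolynomial (Fin 6) ℂ) • A.map C :=
    Matrix.map_smul' C c A fun _ _ => C_mul
  rw [normalEquation, hmap, smul_mulVec, dotProduct_smul, smul_eq_mul, normalEquation]

theorem IsQuadEquation.mobius_rename_eq_normalEquation {Q : MvPolynomial (Fin 4) ℂ}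
    (hQ : IsQuadEquation Q) {f : Fin 4 → Fin 6} (hf : Function.Injective f) {s t : PencilType}
    {M : Fin 4 → Matrix (Fin 2) (Fin 2) ℂ} {A : Matrix (Fin 2) (Fin 2) ℂ}
    (hA : coeffMatrix Q = s.frame (M 0) (M 2) * A * (t.frame (M 1) (M 3))ᵀ)
    {r : Fin 6 → Matrix (Fin 2) (Fin 2) ℂ} (hr : ∀ k, M k * r (f k) = 1) :
    mobius r (rename f Q) = normalEquation s t A f := by
  have hcancel : ∀ k (ξ : Fin 2 → MvPolynomial (Fin 6) ℂ),
      (M k).map C *ᵥ (r (f k)).map C *ᵥ ξ = ξ := fun k ξ => by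
    rw [mulVec_mulVec, ← Matrix.map_mul, hr, Matrix.map_one _ C_0 C_1, one_mulVec]
  rw [hQ.mobius_rename hf, hA, Matrix.map_mul, Matrix.map_mul, transpose_map,
    PencilType.map_frame, PencilType.map_frame, ← mulVec_mulVec, ← mulVec_mulVec,
    dotProduct_mulVec, mulVec_transpose, PencilType.segre_vecMul_frame,
    PencilType.segre_vecMul_frame]
  simp only [hcancel, normalEquation]

theorem OctEquiv.of_eq_C_mul {E E' E'' : Fin 3 → MvPolynomial (Fin 6) ℂ} (h : OctEquiv E E')
    {c : Fin 3 → ℂ} (hc : ∀ i, c i ≠ 0) (hE : ∀ i, E'' i = C (c i) * E' i) : OctEquiv E E'' := by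
  obtain ⟨r, hr, σ, hσ, τ, h⟩ := h
  refine ⟨r, hr, σ, hσ, τ, fun i => ?_⟩
  obtain ⟨d, hd, hi⟩ := h i
  exact ⟨c i * d, mul_ne_zero (hc i) hd, by rw [hE, hi, C_mul, mul_assoc]⟩

theorem octEquiv_normalSystem {Q₁ Q₂ Q₃ : MvPolynomial (Fin 4) ℂ} (h₁ : IsQuadEquation Q₁)
    (h₂ : IsQuadEquation Q₂) (h₃ : IsQuadEquation Q₃) {s₁ s₂ s₃ : PencilType}
    {M : Fin 6 → Matrix (Fin 2) (Fin 2) ℂ} (hM : ∀ i, (M i).det ≠ 0)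
    {A B : Matrix (Fin 2) (Fin 2) ℂ} {k : ℂ} (hk : k ≠ 0)
    (hA : coeffMatrix Q₁ = s₁.frame (M 4) (M 1) * A * (s₂.frame (M 2) (M 5))ᵀ)
    (hB : coeffMatrix Q₂ = s₂.frame (M 2) (M 5) * B * (s₃.frame (M 6) (M 3))ᵀ)
    (hD : coeffMatrix Q₃ =
      s₃.frame (M 6) (M 3) * (k • (Bᵀ * J * Aᵀ)) * (s₁.frame (M 4) (M 1))ᵀ) :
    OctEquiv (octahedron Q₁ Q₂ Q₃) (normalSystem s₁ s₂ s₃ A B) := by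
  have hinv : ∀ i, M i * (M i)⁻¹ = 1 := fun i => mul_nonsing_inv _ (hM i).isUnit
  have hmobius : mobius (fun i => (M i)⁻¹) ∘ octahedron Q₁ Q₂ Q₃ =
      ![normalEquation s₁ s₂ A ![4, 2, 1, 5], normalEquation s₂ s₃ B ![2, 6, 5, 3],
        normalEquation s₃ s₁ (k • (Bᵀ * J * Aᵀ)) ![6, 4, 3, 1]] := by
    ext i : 1
    fin_cases i
    · exact h₁.mobius_rename_eq_normalEquation (M := M ∘ ![4, 2, 1, 5]) (by decide)
        hA fun k => hinv _
    · exact h₂.mobius_rename_eq_normalEquation (M := M ∘ ![2, 6, 5, 3]) (by decide)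
        hB fun k => hinv _
    · exact h₃.mobius_rename_eq_normalEquation (M := M ∘ ![6, 4, 3, 1]) (by decide)
        hD fun k => hinv _
  have hequiv : OctEquiv (octahedron Q₁ Q₂ Q₃) (mobius (fun i => (M i)⁻¹) ∘ octahedron Q₁ Q₂ Q₃) :=
    ⟨_, fun i => (isUnit_nonsing_inv_det _ (hM i).isUnit).ne_zero, 1, one_mem _, 1, fun i =>
      ⟨1, one_ne_zero, by
        rw [Equiv.Perm.coe_one, rename_id_apply, C_1, one_mul, Equiv.Perm.coe_one, id,
          Function.comp_apply]⟩⟩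
  refine hequiv.of_eq_C_mul (c := ![1, 1, k⁻¹]) (by simp [Fin.forall_fin_succ, hk]) ?_
  rw [hmobius]
  simp [Fin.forall_fin_succ, normalSystem, normalEquation_smul, ← mul_assoc, ← C_mul, hk]

/-- The CAO property in terms of coefficient matrices, invariant under cyclic permutations of the
three equations. -/
structure ConsistentTriple (Q₁ Q₂ Q₃ : MvPolynomial (Fin 4) ℂ) : Prop where
  quad₁ : IsQuadEquation Q₁
  quad₂ : IsQuadEquation Q₂
  quad₃ : IsQuadEquation Q₃
  consistent₁ : Consistent (coeffMatrix Q₁) (coeffMatrix Q₂) (coeffMatrix Q₃)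
  consistent₂ : Consistent (coeffMatrix Q₂) (coeffMatrix Q₃) (coeffMatrix Q₁)
  consistent₃ : Consistent (coeffMatrix Q₃) (coeffMatrix Q₁) (coeffMatrix Q₂)

namespace ConsistentTriple

variable {Q₁ Q₂ Q₃ : MvPolynomial (Fin 4) ℂ}

theorem rotate (h : ConsistentTriple Q₁ Q₂ Q₃) : ConsistentTriple Q₂ Q₃ Q₁ :=
  ⟨h.quad₂, h.quad₃, h.quad₁, h.consistent₂, h.consistent₃, h.consistent₁⟩

theorem range_eq_range_transpose (h : ConsistentTriple Q₁ Q₂ Q₃) :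
    LinearMap.range (coeffMatrix Q₁).mulVecLin = LinearMap.range (coeffMatrix Q₃)ᵀ.mulVecLin :=
  h.consistent₁.range_eq_range_transpose h.consistent₂ h.quad₁.nondegenerate h.quad₂.nondegenerate
    h.quad₃.nondegenerate

theorem exists_isTypeOf (h : ConsistentTriple Q₁ Q₂ Q₃) :
    ∃ s : PencilType, s.IsTypeOf (LinearMap.range (coeffMatrix Q₁).mulVecLin) := by
  have hrank := (h.consistent₂.range_le_and_rank_eq_two h.quad₂.nondegenerate
    h.quad₃.nondegenerate h.quad₁.nondegenerate).2
  obtain ⟨v, hv⟩ := exists_eval_ne_zero h.quad₁.nondegenerate.detPoly_ne_zero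
  rw [eval_detPoly] at hv
  exact CAO.exists_isTypeOf hrank (LinearMap.mem_range_self _ _) hv

theorem exists_factorization (h : ConsistentTriple Q₁ Q₂ Q₃)
    {P Q R : Matrix (Fin 2 × Fin 2) (Fin 2) ℂ} {L L' L'' : Matrix (Fin 2) (Fin 2 × Fin 2) ℂ}
    (hP : L * P = 1) (hQ : L' * Q = 1) (hR : L'' * R = 1)
    (hrP : LinearMap.range P.mulVecLin = LinearMap.range (coeffMatrix Q₁).mulVecLin)
    (hrQ : LinearMap.range Q.mulVecLin = LinearMap.range (coeffMatrix Q₂).mulVecLin)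
    (hrR : LinearMap.range R.mulVecLin = LinearMap.range (coeffMatrix Q₃).mulVecLin) :
    ∃ (A B : Matrix (Fin 2) (Fin 2) ℂ) (k : ℂ), k ≠ 0 ∧ coeffMatrix Q₁ = P * A * Qᵀ ∧
      coeffMatrix Q₂ = Q * B * Rᵀ ∧ coeffMatrix Q₃ = R * (k • (Bᵀ * J * Aᵀ)) * Pᵀ := by
  obtain ⟨A, hA⟩ := exists_eq_mul_mul_transpose hP hrP.ge
    (hrQ.trans h.rotate.range_eq_range_transpose).ge
  obtain ⟨B, hB⟩ := exists_eq_mul_mul_transpose hQ hrQ.ge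
    (hrR.trans h.rotate.rotate.range_eq_range_transpose).ge
  obtain ⟨D, hD⟩ := exists_eq_mul_mul_transpose hR hrR.ge
    (hrP.trans h.range_eq_range_transpose).ge
  obtain ⟨k, hk, rfl⟩ := Consistent.exists_eq_smul hP hQ hR (hD ▸ hB ▸ hA ▸ h.consistent₁)
    (hA ▸ h.quad₁.nondegenerate) (hB ▸ h.quad₂.nondegenerate) (hD ▸ h.quad₃.nondegenerate)
  exact ⟨A, B, k, hk, hA, hB, hD⟩

theorem exists_octEquiv_normalSystem (h : ConsistentTriple Q₁ Q₂ Q₃) {s₁ s₂ s₃ : PencilType}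
    (hs₁ : s₁.IsTypeOf (LinearMap.range (coeffMatrix Q₁).mulVecLin))
    (hs₂ : s₂.IsTypeOf (LinearMap.range (coeffMatrix Q₂).mulVecLin))
    (hs₃ : s₃.IsTypeOf (LinearMap.range (coeffMatrix Q₃).mulVecLin)) :
    ∃ A B, OctEquiv (octahedron Q₁ Q₂ Q₃) (normalSystem s₁ s₂ s₃ A B) := by
  obtain ⟨M₄, M₁, hM₄, hM₁, hP⟩ := hs₁
  obtain ⟨M₂, M₅, hM₂, hM₅, hQ⟩ := hs₂
  obtain ⟨M₆, M₃, hM₆, hM₃, hR⟩ := hs₃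
  obtain ⟨_, hP'⟩ := s₁.exists_mul_frame_eq_one hM₄.isUnit hM₁.isUnit
  obtain ⟨_, hQ'⟩ := s₂.exists_mul_frame_eq_one hM₂.isUnit hM₅.isUnit
  obtain ⟨_, hR'⟩ := s₃.exists_mul_frame_eq_one hM₆.isUnit hM₃.isUnit
  obtain ⟨A, B, k, hk, hA, hB, hD⟩ := h.exists_factorization hP' hQ' hR' hP hQ hR
  exact ⟨A, B, octEquiv_normalSystem h.quad₁ h.quad₂ h.quad₃ (M := ![M₆, M₁, M₂, M₃, M₄, M₅])
    (by simp [Fin.forall_fin_succ, *]) hk hA hB hD⟩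

end ConsistentTriple

end NormalForm

section Classification

theorem normalEquation_secant_secant (A : Matrix (Fin 2) (Fin 2) ℂ) (f : Fin 4 → Fin 6) :
    normalEquation .secant .secant A f =
      N3 (u (f 0)) (u (f 1)) (u (f 2)) (u (f 3)) (A 0 0) (A 1 1) (A 0 1) (A 1 0) := by
  simp only [normalEquation, PencilType.form, N3, dotProduct, mulVec, Fin.sum_univ_two, map_apply,
    cons_val_zero, cons_val_one]
  ring

theorem normalEquation_secant_tangent (A : Matrix (Fin 2) (Fin 2) ℂ) (f : Fin 4 → Fin 6) :
    normalEquation .secant .tangent A f =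
      N2 (u (f 1)) (u (f 0)) (u (f 3)) (u (f 2)) (A 0 0) (A 1 0) (A 0 1) (A 1 1) := by
  simp only [normalEquation, PencilType.form, N2, dotProduct, mulVec, Fin.sum_univ_two, map_apply,
    cons_val_zero, cons_val_one]
  ring

theorem normalEquation_tangent_secant (A : Matrix (Fin 2) (Fin 2) ℂ) (f : Fin 4 → Fin 6) :
    normalEquation .tangent .secant A f =
      N2 (u (f 0)) (u (f 1)) (u (f 2)) (u (f 3)) (A 0 0) (A 0 1) (A 1 0) (A 1 1) := by
  simp only [normalEquation, PencilType.form, N2, dotProduct, mulVec, Fin.sum_univ_two, map_apply,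
    cons_val_zero, cons_val_one]
  ring

theorem normalEquation_tangent_tangent (A : Matrix (Fin 2) (Fin 2) ℂ) (f : Fin 4 → Fin 6) :
    normalEquation .tangent .tangent A f =
      N1 (u (f 0)) (u (f 1)) (u (f 2)) (u (f 3)) (A 0 0) (A 0 1) (A 1 0) (A 1 1) := by
  simp only [normalEquation, PencilType.form, N1, dotProduct, mulVec, Fin.sum_univ_two, map_apply,
    cons_val_zero, cons_val_one]
  ring

theorem transpose_mul_J_mul_transpose_apply (A B : Matrix (Fin 2) (Fin 2) ℂ) (i j : Fin 2) :
    (Bᵀ * J * Aᵀ : Matrix (Fin 2) (Fin 2) ℂ) i j = B 0 i * A j 1 - B 1 i * A j 0 := by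
  simp only [mul_apply, J, Fin.sum_univ_two, transpose_apply, of_apply, cons_val_zero, cons_val_one,
    cons_val', cons_val_fin_one]
  ring

theorem normalSystem_secant_tangent_secant (A B : Matrix (Fin 2) (Fin 2) ℂ) :
    normalSystem .secant .tangent .secant A B =
      systemN223 (A 0 0) (A 1 0) (A 0 1) (A 1 1) (B 0 0) (B 0 1) (B 1 0) (B 1 1) := by
  simp only [normalSystem, systemN223, normalEquation_secant_secant, normalEquation_secant_tangent,
    normalEquation_tangent_secant, transpose_mul_J_mul_transpose_apply, cons_val, mul_comm]

theorem normalSystem_tangent_secant_tangent (A B : Matrix (Fin 2) (Fin 2) ℂ) :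
    normalSystem .tangent .secant .tangent A B =
      systemN221 (A 0 0) (A 0 1) (A 1 0) (A 1 1) (B 0 0) (B 1 0) (B 0 1) (B 1 1) := by
  simp only [normalSystem, systemN221, normalEquation_tangent_tangent,
    normalEquation_secant_tangent, normalEquation_tangent_secant,
    transpose_mul_J_mul_transpose_apply, cons_val, mul_comm]

theorem normalSystem_tangent_tangent_tangent (A B : Matrix (Fin 2) (Fin 2) ℂ) :
    normalSystem .tangent .tangent .tangent A B =
      systemN111 (A 0 0) (A 0 1) (A 1 0) (A 1 1) (B 0 0) (B 0 1) (B 1 0) (B 1 1) := by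
  simp only [normalSystem, systemN111, normalEquation_tangent_tangent,
    transpose_mul_J_mul_transpose_apply, cons_val, mul_comm]

theorem OctEquiv.systemN333_of_normalSystem {E : Fin 3 → MvPolynomial (Fin 6) ℂ}
    {A B : Matrix (Fin 2) (Fin 2) ℂ}
    (h : OctEquiv E (normalSystem .secant .secant .secant A B)) :
    OctEquiv E (systemN333 (A 0 0) (A 1 1) (A 0 1) (A 1 0) (B 0 0) (B 1 1) (B 0 1) (B 1 0)) := by
  refine h.of_eq_C_mul (c := ![1, 1, -1]) (by simp [Fin.forall_fin_succ])
    fun | 0 => ?_ | 1 => ?_ | 2 => ?_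
  all_goals
    simp only [systemN333, normalSystem, normalEquation_secant_secant, N3,
      transpose_mul_J_mul_transpose_apply, cons_val, C_1, C_neg, C_sub, C_mul]
    ring

/-- The rotation of the octahedron by a third of a turn, which permutes the three pairs of opposite
vertices cyclically. -/
def rotation : Equiv.Perm (Fin 6) where
  toFun := ![4, 5, 6, 1, 2, 3]
  invFun := ![2, 3, 4, 5, 6, 1]
  left_inv := by decide
  right_inv := by decide

theorem rotation_mem_octahedralGroup : rotation ∈ octahedralGroup := by
  have hprod : rotation = Equiv.swap 1 4 * Equiv.swap 2 5 * [1, 3, 4, 6].formPerm *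
      [1, 2, 4, 5].formPerm := by decide
  rw [hprod]
  refine mul_mem (mul_mem (mul_mem ?_ ?_) ?_) ?_ <;> exact Subgroup.subset_closure (by simp)

theorem octahedron_rotate (Q₁ Q₂ Q₃ : MvPolynomial (Fin 4) ℂ) (i : Fin 3) :
    octahedron Q₃ Q₁ Q₂ i = rename rotation (octahedron Q₁ Q₂ Q₃ (i - 1)) := by
  have hrename : ∀ (f g : Fin 4 → Fin 6) (Q : MvPolynomial (Fin 4) ℂ), g = rotation ∘ f →
      rename g Q = rename rotation (rename f Q) := fun f g Q h => by rw [rename_rename, h]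
  fin_cases i
  · exact hrename ![6, 4, 3, 1] ![4, 2, 1, 5] Q₃ (by decide)
  · exact hrename ![4, 2, 1, 5] ![2, 6, 5, 3] Q₁ (by decide)
  · exact hrename ![2, 6, 5, 3] ![6, 4, 3, 1] Q₂ (by decide)

theorem OctEquiv.of_rotate {Q₁ Q₂ Q₃ : MvPolynomial (Fin 4) ℂ}
    {E : Fin 3 → MvPolynomial (Fin 6) ℂ} (h : OctEquiv (octahedron Q₃ Q₁ Q₂) E) :
    OctEquiv (octahedron Q₁ Q₂ Q₃) E := by
  obtain ⟨r, hr, σ, hσ, τ, h⟩ := h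
  refine ⟨r, hr, σ * rotation, mul_mem hσ rotation_mem_octahedralGroup,
    τ.trans (Equiv.subRight 1), fun i => ?_⟩
  obtain ⟨c, hc, hi⟩ := h i
  refine ⟨c, hc, ?_⟩
  rw [hi, octahedron_rotate, rename_rename]
  rfl

theorem ConsistentTriple.exists_octEquiv_normalSystem_type_eq
    {Q₁ Q₂ Q₃ : MvPolynomial (Fin 4) ℂ} (h : ConsistentTriple Q₁ Q₂ Q₃) :
    ∃ s t A B, OctEquiv (octahedron Q₁ Q₂ Q₃) (normalSystem s t s A B) := by
  obtain ⟨s₁, hs₁⟩ := h.exists_isTypeOf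
  obtain ⟨s₂, hs₂⟩ := h.rotate.exists_isTypeOf
  obtain ⟨s₃, hs₃⟩ := h.rotate.rotate.exists_isTypeOf
  have hpigeonhole : s₁ = s₃ ∨ s₂ = s₁ ∨ s₃ = s₂ := by
    cases s₁ <;> cases s₂ <;> cases s₃ <;> simp
  rcases hpigeonhole with rfl | rfl | rfl
  · obtain ⟨A, B, hE⟩ := h.exists_octEquiv_normalSystem hs₁ hs₂ hs₃
    exact ⟨_, _, A, B, hE⟩
  · obtain ⟨A, B, hE⟩ := h.rotate.exists_octEquiv_normalSystem hs₂ hs₃ hs₁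
    exact ⟨_, _, A, B, hE.of_rotate.of_rotate⟩
  · obtain ⟨A, B, hE⟩ := h.rotate.rotate.exists_octEquiv_normalSystem hs₃ hs₁ hs₂
    exact ⟨_, _, A, B, hE.of_rotate⟩

end Classification

end CAO

theorem mainTheorem2 (Q₁ Q₂ Q₃ : MvPolynomial (Fin 4) ℂ)
    (h₁ : CAO.IsQuadEquation Q₁) (h₂ : CAO.IsQuadEquation Q₂) (h₃ : CAO.IsQuadEquation Q₃)
    (hCAO : CAO.HasCAO (CAO.octahedron Q₁ Q₂ Q₃)) :
    ∃ α₁ α₂ α₃ α₄ α₅ α₆ α₇ α₈ : ℂ,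
      CAO.OctEquiv (CAO.octahedron Q₁ Q₂ Q₃) (CAO.systemN333 α₁ α₂ α₃ α₄ α₅ α₆ α₇ α₈) ∨
      CAO.OctEquiv (CAO.octahedron Q₁ Q₂ Q₃) (CAO.systemN223 α₁ α₂ α₃ α₄ α₅ α₆ α₇ α₈) ∨
      CAO.OctEquiv (CAO.octahedron Q₁ Q₂ Q₃) (CAO.systemN221 α₁ α₂ α₃ α₄ α₅ α₆ α₇ α₈) ∨
      CAO.OctEquiv (CAO.octahedron Q₁ Q₂ Q₃) (CAO.systemN111 α₁ α₂ α₃ α₄ α₅ α₆ α₇ α₈) := by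
  obtain ⟨c₁, c₂, c₃⟩ := hCAO.consistent h₁ h₂ h₃
  have hQ : CAO.ConsistentTriple Q₁ Q₂ Q₃ := ⟨h₁, h₂, h₃, c₁, c₂, c₃⟩
  obtain ⟨s, t, A, B, hE⟩ := hQ.exists_octEquiv_normalSystem_type_eq
  cases s <;> cases t
  case secant.secant => exact ⟨_, _, _, _, _, _, _, _, .inl hE.systemN333_of_normalSystem⟩
  case secant.tangent =>
    rw [CAO.normalSystem_secant_tangent_secant] at hE
    exact ⟨_, _, _, _, _, _, _, _, .inr (.inl hE)⟩
  case tangent.secant =>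
    rw [CAO.normalSystem_tangent_secant_tangent] at hE
    exact ⟨_, _, _, _, _, _, _, _, .inr (.inr (.inl hE))⟩
  case tangent.tangent =>
    rw [CAO.normalSystem_tangent_tangent_tangent] at hE
    exact ⟨_, _, _, _, _, _, _, _, .inr (.inr (.inr hE))⟩
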